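/- Let $d\ge 2$, $\Lambda=\mathrm{diag}(\lambda_1,\dots,\lambda_d)$ with $\lambda_1>\cdots>\lambda_d>0$, and let $\mathcal O_\Lambda=\{Q\Lambda Q^\top : Q\in SO(d)\}$. Let $\mathfrak{so}(d)$ be the space of skew-symmetric $d\times d$ matrices with the Frobenius norm $|\cdot|_F$, $[A,B]=AB-BA$, and for $M,N\in\mathcal O_\Lambda$ put $$d_{\mathcal O}(M,N)=\inf\{|\xi|_F : \xi\in\mathfrak{so}(d),\ M=e^{\xi}Ne^{-\xi}\}.$$ Let $\mathcal I=(\mathcal I_M)_{M\in\mathcal O_\Lambda}$ be an inertia operator: each $\mathcal I_M$ is a linear operator on $\mathfrak{so}(d)$, symmetric and positive definite for the Frobenius inner product, and $\mathcal I_{QMQ^\top}(QAQ^\top)=Q\,\mathcal I_M(A)\,Q^\top$ for $Q\in SO(d)$. Let $\mathcal K_M\xi=-[M,[\xi,M]]$ be the stiffness operator. The spectrum of $\mathcal I_M^{-1}\mathcal K_M$ does not depend on $M$; let $\kappa_{\max}$ be its largest eigenvalue, and $$\mathcal D=\Big\{(\eta,\gamma): 0<\gamma<2,\ 0<\eta<\tfrac{2(2-\gamma)}{\kappa_{\max}}\Big\}.$$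 A target rotates at constant angular velocity $\Omega^*\in\mathfrak{so}(d)$, $M^*_{t+1}=e^{\Omega^*}M^*_te^{-\Omega^*}$ with $M_0^*\in\mathcal O_\Lambda$, and is observed without noise, $C_t=M_t^*$. The damped kick-drift iterates, started at $(M_0,\Omega_0)\in\mathcal O_\Lambda\times\mathfrak{so}(d)$, are $$\Omega_{t+1}=\Omega^*+(1-\gamma)(\Omega_t-\Omega^*)+\eta\,\mathcal I_{M_t}^{-1}[C_t,M_t],\qquad M_{t+1}=e^{\Omega_{t+1}}M_te^{-\Omega_{t+1}} .$$ Let $\rho$ be the spectral radius of the linearized error dynamics $(\xi,u)\mapsto(\xi+u',u')$, $u'=(1-\gamma)u-\eta\,\mathcal I_\Lambda^{-1}\mathcal K_\Lambda\xi$, on $\mathfrak{so}(d)\times\mathfrak{so}(d)$, and let $e_t=d_{\mathcal O}(M_t,M_t^*)+|\Omega_t-\Omega^*|_F$. **Theorem (zero-lag tracking).** Let $(\eta,\gamma)\in\mathcal D$. Then $\rho<1$, and for every $r$ with $\rho<r<1$ there are $\omega_0,\delta,K>0$, depending only on $\Lambda,\mathcal I,\eta,\gamma,r$, such that the following holds for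 every $\Omega^*\in\mathfrak{so}(d)$ if $d=2$, and for every $\Omega^*\in\mathfrak{so}(d)$ with $|\Omega^*|_F<\omega_0$ if $d\ge 3$: for all $M_0^*,M_0\in\mathcal O_\Lambda$ and $\Omega_0\in\mathfrak{so}(d)$ with $e_0<\delta$, $$e_t\le K\,r^t\,e_0\quad\text{for all } t\ge 0,\qquad\text{and}\qquad \lim_{t\to\infty}d_{\mathcal O}(M_t,M_t^*)=0 .$$ -/

import Mathlib

open Matrix Filter Topology
open scoped ENNReal

noncomputable section

namespace KGMRF

/-- The Lie algebra of real skew-symmetric `d × d` matrices. -/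
def so (d : ℕ) : Submodule ℝ (Matrix (Fin d) (Fin d) ℝ) where
  carrier := {A | Aᵀ = -A}
  add_mem' := by
    intro A B hA hB
    simp only [Set.mem_ofPred_eq] at hA hB ⊢
    rw [Matrix.transpose_add, hA, hB, neg_add]
  zero_mem' := by simp
  smul_mem' := by
    intro c A hA
    simp only [Set.mem_ofPred_eq] at hA ⊢
    rw [Matrix.transpose_smul, hA, smul_neg]

theorem mem_so_iff {d : ℕ} {A : Matrix (Fin d) (Fin d) ℝ} : A ∈ so d ↔ Aᵀ = -A := Iff.rfl

/-- The group of rotations of `ℝ^d`. -/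
abbrev SO (d : ℕ) : Submonoid (Matrix (Fin d) (Fin d) ℝ) :=
  Matrix.specialOrthogonalGroup (Fin d) ℝ

/-- The Frobenius inner product `tr(AᵀB)`. -/
def frobInner {d : ℕ} (A B : Matrix (Fin d) (Fin d) ℝ) : ℝ := (Aᵀ * B).trace

/-- The Frobenius norm. -/
def frobNorm {d : ℕ} (A : Matrix (Fin d) (Fin d) ℝ) : ℝ := √(frobInner A A)

theorem mem_SO_iff {d : ℕ} {Q : Matrix (Fin d) (Fin d) ℝ} :
    Q ∈ SO d ↔ Q * Qᵀ = 1 ∧ Q.det = 1 := by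
  rw [Matrix.mem_specialOrthogonalGroup_iff, Matrix.mem_orthogonalGroup_iff]

theorem SO_transpose_mul {d : ℕ} (Q : SO d) :
    (Q : Matrix (Fin d) (Fin d) ℝ)ᵀ * (Q : Matrix (Fin d) (Fin d) ℝ) = 1 :=
  mul_eq_one_comm.mp (mem_SO_iff.mp Q.2).1

theorem so_transpose {d : ℕ} (A : so d) :
    (A : Matrix (Fin d) (Fin d) ℝ)ᵀ = -(A : Matrix (Fin d) (Fin d) ℝ) :=
  mem_so_iff.mp A.2

theorem exp_mem_SO {d : ℕ} (A : so d) :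
    NormedSpace.exp (A : Matrix (Fin d) (Fin d) ℝ) ∈ SO d := by
  have key : ∀ B : Matrix (Fin d) (Fin d) ℝ, Bᵀ = -B →
      NormedSpace.exp B * (NormedSpace.exp B)ᵀ = 1 := by
    intro B hB
    rw [← Matrix.exp_transpose, hB, ← Matrix.exp_add_of_commute _ _ (Commute.refl B).neg_right]
    simp
  refine mem_SO_iff.mpr ⟨key _ (so_transpose A), ?_⟩
  set B : Matrix (Fin d) (Fin d) ℝ := (1 / 2 : ℝ) • (A : Matrix (Fin d) (Fin d) ℝ) with hB
  have h1 : (A : Matrix (Fin d) (Fin d) ℝ) = B + B := by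
    rw [hB, ← add_smul]; norm_num
  have h2 := congrArg Matrix.det (key B (by
    rw [hB, Matrix.transpose_smul, so_transpose A, smul_neg]))
  rw [h1, Matrix.exp_add_of_commute _ _ (Commute.refl B), Matrix.det_mul]
  simpa [Matrix.det_mul, Matrix.det_transpose] using h2

/-- The matrix exponential `so(d) → SO(d)`. -/
def expSO {d : ℕ} (A : so d) : SO d :=
  ⟨NormedSpace.exp (A : Matrix (Fin d) (Fin d) ℝ), exp_mem_SO A⟩

/-- The isospectral orbit `{Q Λ Qᵀ : Q ∈ SO(d)}` of `Λ = diag(lam)`. -/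
def orbit {d : ℕ} (lam : Fin d → ℝ) : Set (Matrix (Fin d) (Fin d) ℝ) :=
  {M | ∃ Q ∈ SO d, M = Q * Matrix.diagonal lam * Qᵀ}

theorem orbit_symm {d : ℕ} {lam : Fin d → ℝ} (M : orbit lam) :
    (M : Matrix (Fin d) (Fin d) ℝ)ᵀ = (M : Matrix (Fin d) (Fin d) ℝ) := by
  obtain ⟨Q, -, h⟩ := M.2
  rw [h]
  simp [Matrix.mul_assoc]

/-- The point `Λ` of the orbit. -/
def basePoint {d : ℕ} (lam : Fin d → ℝ) : orbit lam :=
  ⟨Matrix.diagonal lam, 1, (SO d).one_mem, by simp⟩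

/-- The action `M ↦ Q M Qᵀ` of a rotation on the orbit. -/
def rotate {d : ℕ} {lam : Fin d → ℝ} (Q : SO d) (M : orbit lam) : orbit lam :=
  ⟨(Q : Matrix (Fin d) (Fin d) ℝ) * M * (Q : Matrix (Fin d) (Fin d) ℝ)ᵀ, by
    obtain ⟨P, hP, h⟩ := M.2
    refine ⟨Q * P, (SO d).mul_mem Q.2 hP, ?_⟩
    rw [h, Matrix.transpose_mul]
    simp only [Matrix.mul_assoc]⟩

/-- The adjoint action `A ↦ Q A Qᵀ` of a rotation on `so(d)`. -/
def adjoint {d : ℕ} (Q : SO d) (A : so d) : so d :=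
  ⟨(Q : Matrix (Fin d) (Fin d) ℝ) * A * (Q : Matrix (Fin d) (Fin d) ℝ)ᵀ, by
    rw [mem_so_iff]
    simp [so_transpose A, Matrix.mul_assoc]⟩

/-- The distance on the orbit: the least Frobenius norm of a logarithm `ξ ∈ so(d)` with
`M = exp(ξ) N exp(ξ)ᵀ`, i.e. the geodesic distance of the metric that the bi-invariant metric
of `SO(d)` induces on `SO(d)/Stab(Λ)`. -/
def orbitDist {d : ℕ} {lam : Fin d → ℝ} (M N : orbit lam) : ℝ≥0∞ :=
  ⨅ (ξ : so d) (_ : rotate (expSO ξ) N = M),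
    ENNReal.ofReal (frobNorm (ξ : Matrix (Fin d) (Fin d) ℝ))

/-- The torque `τ(M, C) = [C, M]` of the observation `C` at the state `M`. -/
def torque {d : ℕ} {lam : Fin d → ℝ} (M C : orbit lam) : so d :=
  ⟨(C : Matrix (Fin d) (Fin d) ℝ) * M - (M : Matrix (Fin d) (Fin d) ℝ) * C, by
    rw [mem_so_iff]
    simp [orbit_symm M, orbit_symm C]⟩

/-- The stiffness operator `𝒦_M ξ = -[M, [ξ, M]]` on `so(d)`. -/
def stiffness {d : ℕ} {lam : Fin d → ℝ} (M : orbit lam) : so d →ₗ[ℝ] so d where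
  toFun ξ := ⟨-((M : Matrix (Fin d) (Fin d) ℝ) *
        ((ξ : Matrix (Fin d) (Fin d) ℝ) * M - (M : Matrix (Fin d) (Fin d) ℝ) * ξ) -
      ((ξ : Matrix (Fin d) (Fin d) ℝ) * M - (M : Matrix (Fin d) (Fin d) ℝ) * ξ) * M), by
    rw [mem_so_iff]
    simp only [Matrix.transpose_neg, Matrix.transpose_sub, Matrix.transpose_mul,
      orbit_symm M, so_transpose ξ]
    noncomm_ring⟩
  map_add' ξ ζ := by
    apply Subtype.ext
    simp only [Submodule.coe_add]
    noncomm_ring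
  map_smul' c ξ := by
    apply Subtype.ext
    simp only [Submodule.coe_smul, RingHom.id_apply, Matrix.smul_mul, Matrix.mul_smul,
      ← smul_sub, ← smul_neg]

/-- An inertia operator: a family `𝓘_M`, `M` in the orbit, of linear operators on `so(d)` that are
symmetric and positive definite for the Frobenius inner product and that is equivariant under
rotations (so that it is determined by `𝓘_Λ`). A symmetric positive definite operator is
invertible, so it is recorded as a linear equivalence. -/
structure Inertia {d : ℕ} (lam : Fin d → ℝ) where
  /-- the operator `𝓘_M` -/
  op : orbit lam → (so d ≃ₗ[ℝ] so d)
  symm' : ∀ (M : orbit lam) (A B : so d),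
    frobInner (op M A : Matrix (Fin d) (Fin d) ℝ) B =
      frobInner (A : Matrix (Fin d) (Fin d) ℝ) (op M B)
  posDef' : ∀ (M : orbit lam) (A : so d), A ≠ 0 →
    0 < frobInner (op M A : Matrix (Fin d) (Fin d) ℝ) A
  equivariant' : ∀ (Q : SO d) (M : orbit lam) (A : so d),
    op (rotate Q M) (adjoint Q A) = adjoint Q (op M A)

/-- The operator `𝓘⁻¹ 𝒦` on `so(d)` at the point `M`. -/
def modeOp {d : ℕ} {lam : Fin d → ℝ} (J : Inertia lam) (M : orbit lam) : so d →ₗ[ℝ] so d :=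
  (J.op M).symm.toLinearMap ∘ₗ stiffness M

/-- `κ_max`, the largest eigenvalue of `𝓘⁻¹ 𝒦`. By equivariance the spectrum of `𝓘⁻¹ 𝒦` is the
same at all points of the orbit; it is taken at `Λ`. -/
def kappaMax {d : ℕ} {lam : Fin d → ℝ} (J : Inertia lam) : ℝ :=
  sSup {κ : ℝ | Module.End.HasEigenvalue (modeOp J (basePoint lam)) κ}

/-- The stability domain `𝒟` of pairs `(η, γ)`. -/
def stabilityDomain {d : ℕ} {lam : Fin d → ℝ} (J : Inertia lam) : Set (ℝ × ℝ) :=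
  {p | 0 < p.2 ∧ p.2 < 2 ∧ 0 < p.1 ∧ p.1 < 2 * (2 - p.2) / kappaMax J}

/-- The linearized error dynamics (discrete damped oscillator) `(ξ, u) ↦ (ξ + u', u')`,
`u' = (1 - γ) u - η 𝓘⁻¹ 𝒦 ξ`, on `so(d) × so(d)`. -/
def errorMap {d : ℕ} {lam : Fin d → ℝ} (J : Inertia lam) (η γ : ℝ) :
    (so d × so d) →ₗ[ℝ] (so d × so d) :=
  let kick : (so d × so d) →ₗ[ℝ] so d :=
    (1 - γ) • LinearMap.snd ℝ (so d) (so d) -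
      η • (modeOp J (basePoint lam) ∘ₗ LinearMap.fst ℝ (so d) (so d))
  LinearMap.prod (LinearMap.fst ℝ (so d) (so d) + kick) kick

/-- The spectral radius of the linearized error dynamics (complex eigenvalues included). -/
def errorRate {d : ℕ} {lam : Fin d → ℝ} (J : Inertia lam) (η γ : ℝ) : ℝ≥0∞ :=
  spectralRadius ℂ (A := Module.End ℂ (TensorProduct ℝ ℂ (so d × so d)))
    ((errorMap J η γ).baseChange ℂ)

/-- The target `M⋆_{t+1} = exp(Ω⋆) M⋆_t exp(Ω⋆)ᵀ` rotating at constant angular velocity. -/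
def target {d : ℕ} {lam : Fin d → ℝ} (Ωs : so d) (Ms0 : orbit lam) : ℕ → orbit lam
  | 0 => Ms0
  | t + 1 => rotate (expSO Ωs) (target Ωs Ms0 t)

/-- One damped kick-drift step from `(M, Ω)` with observation `C`: the kick
`Ω' = Ω⋆ + (1 - γ)(Ω - Ω⋆) + η 𝓘_M⁻¹ τ(M, C)`, then the drift `M' = exp(Ω') M exp(Ω')ᵀ`. -/
def kickDrift {d : ℕ} {lam : Fin d → ℝ} (J : Inertia lam) (η γ : ℝ) (Ωs : so d)
    (C : orbit lam) (x : orbit lam × so d) : orbit lam × so d :=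
  let Ω' : so d := Ωs + (1 - γ) • (x.2 - Ωs) + η • (J.op x.1).symm (torque x.1 C)
  (rotate (expSO Ω') x.1, Ω')

/-- The iterates `(M_t, Ω_t)` with the noiseless observations `C_t = M⋆_t`. -/
def iterates {d : ℕ} {lam : Fin d → ℝ} (J : Inertia lam) (η γ : ℝ) (Ωs : so d)
    (Ms0 M0 : orbit lam) (Ω0 : so d) : ℕ → orbit lam × so d
  | 0 => (M0, Ω0)
  | t + 1 => kickDrift J η γ Ωs (target Ωs Ms0 t) (iterates J η γ Ωs Ms0 M0 Ω0 t)

/-- The tracking error at time `t`: configuration error plus velocity error. -/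
def trackingError {d : ℕ} {lam : Fin d → ℝ} (J : Inertia lam) (η γ : ℝ) (Ωs : so d)
    (Ms0 M0 : orbit lam) (Ω0 : so d) (t : ℕ) : ℝ≥0∞ :=
  orbitDist (iterates J η γ Ωs Ms0 M0 Ω0 t).1 (target Ωs Ms0 t) +
    ENNReal.ofReal (frobNorm
      (((iterates J η γ Ωs Ms0 M0 Ω0 t).2 - Ωs : so d) : Matrix (Fin d) (Fin d) ℝ))

end KGMRF

end

open KGMRF

/-! Write the state as `M = QΛQᵀ` and use its body frame: the target is `Q e^{-ξ} Λ e^{ξ} Qᵀ`, the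
velocity is `Ω⋆ + Q v Qᵀ`, and `w = QᵀΩ⋆Q`. By equivariance of torque and inertia, one step depends
only on `w` and `x = (ξ, v)`. With `k` the velocity error after the kick, it sends `e^ξ` to `e^ξ
e^{-w} e^{w+k}` and `v` to `e^{-(w+k)} k e^{w+k}` (`IsBodyError.step`). Zero error is fixed for
every `w`, which is the absence of lag.

At `(w, x) = (0, 0)` this map is strictly differentiable with derivative `errorMap` in `x` and zero
in `w`. So for small `w` and `x` it differs from `errorMap` by at most `ε‖x‖`
(`norm_bodyStep_sub_errorMap_le`). The frame, hence `w`, changes at every step, but `|w|` stays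
equal to `|Ω⋆|`. When `d = 2` everything commutes and `w` drops out.

Since `𝓘⁻¹𝒦` is diagonalizable with positive eigenvalues `κ`, the error dynamics reduces to the
quadratics `z² - (2 - γ - ηκ) z + (1 - γ)`, and Jury's criterion places their roots in the open unit
disc (`errorRate_lt_one`). A norm adapted to a rate between `ρ` and `r` (`exists_adapted_norm`)
leaves room for the nonlinear remainder, so each step contracts by `r` (`exists_contraction`). -/

namespace KGMRF

/-! ### Spectra of symmetric operators and complexifications; roots of quadratics -/

section SpectralTheory

open Polynomial

/-- The eigenspaces of an operator that is symmetric for a positive definite bilinear form span. -/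
theorem iSup_eigenspace_eq_top_of_symmetric {V : Type*} [AddCommGroup V] [Module ℝ V]
    [FiniteDimensional ℝ V] (B : V →ₗ[ℝ] V →ₗ[ℝ] ℝ) (hsymm : ∀ x y, B x y = B y x)
    (hpos : ∀ x, x ≠ 0 → 0 < B x x) (T : Module.End ℝ V) (hT : ∀ x y, B (T x) y = B x (T y)) :
    ⨆ μ, Module.End.eigenspace T μ = ⊤ := by
  let core : InnerProductSpace.Core ℝ V :=
    { inner := fun x y => B x y
      conj_inner_symm := fun x y => by simpa using hsymm y x
      re_inner_nonneg := fun x => by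
        rcases eq_or_ne x 0 with rfl | h
        · simp
        · simpa using (hpos x h).le
      add_left := fun x y z => by simp
      smul_left := fun x y c => by simp
      definite := fun x h => by
        by_contra hx
        exact (hpos x hx).ne' h }
  let _ : NormedAddCommGroup V := core.toNormedAddCommGroup
  let _ : InnerProductSpace ℝ V := InnerProductSpace.ofCore core.toCore
  have h : LinearMap.IsSymmetric T := fun x y => hT x y
  exact Submodule.orthogonal_eq_bot_iff.mp h.orthogonalComplement_iSup_eigenspaces_eq_bot

/-- The eigenvalues of the complexification of a real operator are roots of the real polynomials
that annihilate the operator. -/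
theorem eval_eq_zero_of_mem_spectrum_baseChange {V : Type*} [AddCommGroup V] [Module ℝ V]
    (T : Module.End ℝ V) (p : ℝ[X]) (hp : aeval T p = 0) (z : ℂ)
    (hz : z ∈ spectrum ℂ (A := Module.End ℂ (TensorProduct ℝ ℂ V)) (T.baseChange ℂ)) :
    aeval z p = 0 := by
  have h0 : aeval (T.baseChange ℂ : Module.End ℂ (TensorProduct ℝ ℂ V))
      (p.map (algebraMap ℝ ℂ)) = 0 := by
    rw [aeval_map_algebraMap]
    have := Polynomial.aeval_algHom_apply (Module.End.baseChangeHom ℝ ℂ V) T p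
    rw [hp, map_zero] at this
    exact this
  have h1 := spectrum.subset_polynomial_aeval (𝕜 := ℂ)
    (T.baseChange ℂ : Module.End ℂ (TensorProduct ℝ ℂ V)) (p.map (algebraMap ℝ ℂ)) ⟨z, hz, rfl⟩
  rw [h0] at h1
  -- `p(z)` lies in the spectrum of the zero operator; a nonzero scalar would be invertible.
  have h2 : eval z (p.map (algebraMap ℝ ℂ)) = 0 := by
    by_contra hne
    rw [spectrum.mem_iff, sub_zero] at h1
    exact h1 ((IsUnit.mk0 _ hne).map (algebraMap ℂ _))
  rwa [eval_map_algebraMap] at h2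

/-- Jury's criterion: the roots of `z² - a z + b` lie in the open unit disc if `|b| < 1` and
`|a| < 1 + b`. -/
theorem norm_lt_one_of_quadratic {a b : ℝ} (hb : |b| < 1) (hab : |a| < 1 + b) {z : ℂ}
    (hz : z ^ 2 - a * z + b = 0) : ‖z‖ < 1 := by
  rw [abs_lt] at hb hab
  have hre := congrArg Complex.re hz
  have him := congrArg Complex.im hz
  simp [pow_two] at hre him
  have hsq : z.re ^ 2 + z.im ^ 2 < 1 := by
    rcases eq_or_ne z.im 0 with h0 | h0
    · rw [h0] at hre ⊢
      by_contra! hcon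
      have h1 : 1 ≤ z.re ^ 2 := by linarith
      rcases le_or_gt 0 z.re with hx | hx
      · have : 1 ≤ z.re := by nlinarith
        nlinarith
      · have : z.re ≤ -1 := by nlinarith
        nlinarith
    -- For a non-real root the imaginary part gives `a = 2 Re z`, and then the real part gives `|z|²
    -- = b`.
    · have h1 : z.re + z.re - a = 0 := by
        apply mul_right_cancel₀ h0
        linarith
      have h2 : a = z.re + z.re := by linarith
      rw [h2] at hre
      nlinarith
  have : ‖z‖ ^ 2 < 1 := by
    rw [Complex.sq_norm, Complex.normSq_apply]; linarith
  nlinarith [norm_nonneg z]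

end SpectralTheory

variable {d : ℕ} {lam : Fin d → ℝ}

/-! ### The Frobenius inner product -/

section Frobenius

theorem frobInner_add_left (A B C : Matrix (Fin d) (Fin d) ℝ) :
    frobInner (A + B) C = frobInner A C + frobInner B C := by
  simp [frobInner, Matrix.add_mul]

theorem frobInner_smul_left (c : ℝ) (A C : Matrix (Fin d) (Fin d) ℝ) :
    frobInner (c • A) C = c * frobInner A C := by
  simp [frobInner]

theorem frobInner_comm (A B : Matrix (Fin d) (Fin d) ℝ) : frobInner A B = frobInner B A := by
  rw [frobInner, ← Matrix.trace_transpose, Matrix.transpose_mul, Matrix.transpose_transpose,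
    frobInner]

theorem frobInner_self (A : Matrix (Fin d) (Fin d) ℝ) : frobInner A A = ∑ i, ∑ j, A i j ^ 2 := by
  rw [Finset.sum_comm]
  simp [frobInner, Matrix.trace, Matrix.mul_apply, pow_two]

theorem frobInner_self_pos {A : Matrix (Fin d) (Fin d) ℝ} (hA : A ≠ 0) : 0 < frobInner A A := by
  rw [frobInner_self]
  refine lt_of_le_of_ne (by positivity) fun h => hA ?_
  ext i j
  have h1 := (Finset.sum_eq_zero_iff_of_nonneg (fun i _ => by positivity)).mp h.symm i
    (Finset.mem_univ i)
  have h2 := (Finset.sum_eq_zero_iff_of_nonneg (fun i _ => by positivity)).mp h1 j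
    (Finset.mem_univ j)
  simpa using h2

/-- The Frobenius inner product as a bilinear form on `so d`. -/
noncomputable def frobForm (d : ℕ) : so d →ₗ[ℝ] so d →ₗ[ℝ] ℝ :=
  LinearMap.mk₂ ℝ (fun A B => frobInner (A : Matrix (Fin d) (Fin d) ℝ) B)
    (fun A B C => frobInner_add_left _ _ _) (fun c A B => frobInner_smul_left _ _ _)
    (fun A B C => by
      simp only [frobInner_comm (A : Matrix (Fin d) (Fin d) ℝ)]
      exact frobInner_add_left _ _ _)
    (fun c A B => by
      simp only [frobInner_comm (A : Matrix (Fin d) (Fin d) ℝ)]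
      exact frobInner_smul_left _ _ _)

end Frobenius

/-! ### Diagonalization and positivity of `𝓘⁻¹𝒦` -/

theorem frobInner_stiffness (M : orbit lam) (ξ ζ : so d) :
    frobInner (stiffness M ξ : Matrix (Fin d) (Fin d) ℝ) ζ =
      frobInner
        ((ξ : Matrix (Fin d) (Fin d) ℝ) * (M : Matrix (Fin d) (Fin d) ℝ) -
          (M : Matrix (Fin d) (Fin d) ℝ) * (ξ : Matrix (Fin d) (Fin d) ℝ))
        ((ζ : Matrix (Fin d) (Fin d) ℝ) * (M : Matrix (Fin d) (Fin d) ℝ) -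
          (M : Matrix (Fin d) (Fin d) ℝ) * (ζ : Matrix (Fin d) (Fin d) ℝ)) := by
  obtain ⟨x, hx⟩ := ξ
  have hM := orbit_symm M
  rw [mem_so_iff] at hx
  simp only [stiffness, LinearMap.coe_mk, AddHom.coe_mk]
  generalize (M : Matrix (Fin d) (Fin d) ℝ) = m at *
  generalize (ζ : Matrix (Fin d) (Fin d) ℝ) = z
  have hy : (x * m - m * x)ᵀ = x * m - m * x := by
    simp only [transpose_sub, transpose_mul, hx, hM]
    noncomm_ring
  generalize x * m - m * x = y at *
  simp only [frobInner, transpose_neg, transpose_sub, transpose_mul, hy, hM]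
  rw [show -(y * m - m * y) * z = m * (y * z) - y * (m * z) by noncomm_ring,
    show y * (z * m - m * z) = y * z * m - y * (m * z) by noncomm_ring,
    Matrix.trace_sub, Matrix.trace_sub, Matrix.trace_mul_comm m]

/-- The entries of `[ξ, Λ]` are `ξ_ij (λ_j - λ_i)`, so simplicity of the spectrum leaves only
diagonal matrices in the kernel, and a skew matrix has zero diagonal. -/
theorem commutator_basePoint_ne_zero (hlam : StrictAnti lam) {ξ : so d} (hξ : ξ ≠ 0) :
    (ξ : Matrix (Fin d) (Fin d) ℝ) * (basePoint lam : Matrix (Fin d) (Fin d) ℝ) -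
      (basePoint lam : Matrix (Fin d) (Fin d) ℝ) * (ξ : Matrix (Fin d) (Fin d) ℝ) ≠ 0 := by
  intro h
  apply hξ
  ext i j
  have hij := congrFun (congrFun h i) j
  have hs := congrFun (congrFun (so_transpose ξ) i) j
  simp [basePoint, Matrix.mul_diagonal, Matrix.diagonal_mul] at hij hs
  rcases eq_or_ne i j with rfl | hne
  · have : (ξ : Matrix (Fin d) (Fin d) ℝ) i i = 0 := by linarith
    simpa using this
  · have h1 : lam j - lam i ≠ 0 := sub_ne_zero.mpr fun h => hne (hlam.injective h).symm
    have : (ξ : Matrix (Fin d) (Fin d) ℝ) i j = 0 := by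
      apply mul_right_cancel₀ h1
      linarith
    simpa using this

/-- The bilinear form of the inertia operator. -/
noncomputable def inertiaForm (J : Inertia lam) (M : orbit lam) : so d →ₗ[ℝ] so d →ₗ[ℝ] ℝ :=
  frobForm d ∘ₗ (J.op M).toLinearMap

theorem inertiaForm_apply (J : Inertia lam) (M : orbit lam) (A B : so d) :
    inertiaForm J M A B = frobInner (J.op M A : Matrix (Fin d) (Fin d) ℝ) B := rfl

theorem inertiaForm_modeOp (J : Inertia lam) (M : orbit lam) (A B : so d) :
    inertiaForm J M (modeOp J M A) B = frobInner (stiffness M A : Matrix (Fin d) (Fin d) ℝ) B := by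
  rw [inertiaForm_apply, modeOp]
  simp

theorem inertiaForm_comm (J : Inertia lam) (M : orbit lam) (A B : so d) :
    inertiaForm J M A B = inertiaForm J M B A := by
  rw [inertiaForm_apply, inertiaForm_apply, J.symm', frobInner_comm]

/-- The right inner product is `⟨𝓘A, B⟩`: it turns `𝓘⁻¹𝒦` into the form `⟨[A, M], [B, M]⟩`, which is
symmetric in `A` and `B`. -/
theorem iSup_eigenspace_modeOp (J : Inertia lam) (M : orbit lam) :
    ⨆ μ, Module.End.eigenspace (modeOp J M) μ = ⊤ := by
  refine iSup_eigenspace_eq_top_of_symmetric (inertiaForm J M) (inertiaForm_comm J M)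
    (fun x hx => J.posDef' M x hx) _ fun x y => ?_
  rw [inertiaForm_modeOp, inertiaForm_comm, inertiaForm_modeOp, frobInner_stiffness,
    frobInner_stiffness, frobInner_comm]

theorem eigenvalue_modeOp_pos (hlam : StrictAnti lam) (J : Inertia lam) {κ : ℝ}
    (hκ : Module.End.HasEigenvalue (modeOp J (basePoint lam)) κ) : 0 < κ := by
  obtain ⟨ξ, hξ⟩ := hκ.exists_hasEigenvector
  have h1 := inertiaForm_modeOp J (basePoint lam) ξ ξ
  rw [frobInner_stiffness, hξ.apply_eq_smul, map_smul, LinearMap.smul_apply, smul_eq_mul] at h1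
  have h2 := frobInner_self_pos (commutator_basePoint_ne_zero hlam hξ.2)
  have h3 : 0 < inertiaForm J (basePoint lam) ξ ξ := J.posDef' _ _ hξ.2
  rw [← h1] at h2
  exact pos_of_mul_pos_left h2 h3.le

theorem eigenvalue_modeOp_le_kappaMax (J : Inertia lam) {κ : ℝ}
    (hκ : Module.End.HasEigenvalue (modeOp J (basePoint lam)) κ) : κ ≤ kappaMax J :=
  le_csSup (Module.End.finite_hasEigenvalue _).bddAbove hκ

/-! ### The spectral radius of the linearized error dynamics -/

section ErrorMap

open Polynomial

/-- The characteristic polynomial of the error dynamics in a mode of eigenvalue `κ`. -/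
noncomputable def modePoly (η γ κ : ℝ) : ℝ[X] := X ^ 2 - C (2 - γ - η * κ) * X + C (1 - γ)

theorem errorMap_apply (J : Inertia lam) (η γ : ℝ) (ξ u : so d) :
    errorMap J η γ (ξ, u) =
      (ξ + ((1 - γ) • u - η • modeOp J (basePoint lam) ξ),
        (1 - γ) • u - η • modeOp J (basePoint lam) ξ) := rfl

/-- Cayley–Hamilton in one mode: there the dynamics is a 2×2 matrix of trace `2 - γ - ηκ` and
determinant `1 - γ`. -/
theorem aeval_modePoly_errorMap (J : Inertia lam) (η γ κ : ℝ) {ξ u : so d}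
    (hξ : modeOp J (basePoint lam) ξ = κ • ξ) (hu : modeOp J (basePoint lam) u = κ • u) :
    aeval (errorMap J η γ : Module.End ℝ (so d × so d)) (modePoly η γ κ) (ξ, u) = 0 := by
  simp only [modePoly, map_add, map_sub, map_mul, aeval_X, aeval_C, LinearMap.add_apply,
    LinearMap.sub_apply, pow_two, Module.End.mul_apply, Module.algebraMap_end_apply,
    errorMap_apply, map_smul, hξ, hu]
  ext1
  · simp only [Prod.fst_add, Prod.fst_sub, Prod.smul_fst, Prod.fst_zero]
    module
  · simp only [Prod.snd_add, Prod.snd_sub, Prod.smul_snd, Prod.snd_zero]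
    module

/-- The modes span, so the product over all `κ` annihilates the whole space. This controls the
complex eigenvalues without diagonalizing `errorMap`, whose mode polynomials may have double roots.
-/
theorem exists_annihilating_poly (J : Inertia lam) (η γ : ℝ) :
    ∃ s : Finset ℝ, (∀ κ ∈ s, Module.End.HasEigenvalue (modeOp J (basePoint lam)) κ) ∧
      aeval (errorMap J η γ : Module.End ℝ (so d × so d)) (∏ κ ∈ s, modePoly η γ κ) = 0 := by
  classical
  set T : Module.End ℝ (so d) := modeOp J (basePoint lam)
  set E : Module.End ℝ (so d × so d) := errorMap J η γ
  have hfin : {κ | T.HasEigenvalue κ}.Finite := Module.End.finite_hasEigenvalue _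
  refine ⟨hfin.toFinset, fun κ hκ => by simpa using hκ, ?_⟩
  set P := ∏ κ ∈ hfin.toFinset, modePoly η γ κ
  have key : ∀ (κ : ℝ) (ξ u : so d), T ξ = κ • ξ → T u = κ • u → aeval E P (ξ, u) = 0 := by
    intro κ ξ u hξ hu
    by_cases hx : κ ∈ hfin.toFinset
    · obtain ⟨q, hq⟩ := Finset.dvd_prod_of_mem (modePoly η γ) hx
      rw [show P = q * modePoly η γ κ by rw [mul_comm]; exact hq, map_mul, Module.End.mul_apply,
        aeval_modePoly_errorMap J η γ κ hξ hu, map_zero]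
    · have hbot : Module.End.eigenspace T κ = ⊥ := by
        by_contra h
        exact hx (by simpa using Module.End.hasEigenvalue_iff.mpr h)
      have h1 : ξ = 0 := by
        have : ξ ∈ Module.End.eigenspace T κ := Module.End.mem_eigenspace_iff.mpr hξ
        simpa [hbot] using this
      have h2 : u = 0 := by
        have : u ∈ Module.End.eigenspace T κ := Module.End.mem_eigenspace_iff.mpr hu
        simpa [hbot] using this
      rw [h1, h2]
      exact map_zero _
  have top := iSup_eigenspace_modeOp J (basePoint lam)
  have hl : aeval E P ∘ₗ LinearMap.inl ℝ (so d) (so d) = 0 := by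
    rw [← LinearMap.ker_eq_top, eq_top_iff, ← top, iSup_le_iff]
    intro κ ξ hξ
    exact key κ ξ 0 (Module.End.mem_eigenspace_iff.mp hξ) (by simp)
  have hr : aeval E P ∘ₗ LinearMap.inr ℝ (so d) (so d) = 0 := by
    rw [← LinearMap.ker_eq_top, eq_top_iff, ← top, iSup_le_iff]
    intro κ ξ hξ
    exact key κ 0 ξ (by simp) (Module.End.mem_eigenspace_iff.mp hξ)
  exact LinearMap.prod_ext hl hr

theorem errorRate_lt_one (hlam : StrictAnti lam) (J : Inertia lam) {η γ : ℝ}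
    (hD : (η, γ) ∈ stabilityDomain J) : errorRate J η γ < 1 := by
  obtain ⟨hγ0, hγ2, hη, hηκ⟩ := hD
  simp only at hγ0 hγ2 hη hηκ
  obtain ⟨s, hs, hP⟩ := exists_annihilating_poly J η γ
  have hroot : ∀ z ∈ spectrum ℂ (A := Module.End ℂ (TensorProduct ℝ ℂ (so d × so d)))
      ((errorMap J η γ).baseChange ℂ), (‖z‖₊ : ℝ≥0∞) < 1 := by
    intro z hz
    have h := eval_eq_zero_of_mem_spectrum_baseChange _ _ hP z hz
    rw [map_prod, Finset.prod_eq_zero_iff] at h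
    obtain ⟨κ, hκ, h⟩ := h
    have hpos := eigenvalue_modeOp_pos hlam J (hs κ hκ)
    have hle := eigenvalue_modeOp_le_kappaMax J (hs κ hκ)
    have hlt : η * κ < 2 * (2 - γ) :=
      (mul_le_mul_of_nonneg_left hle hη.le).trans_lt ((lt_div_iff₀ (hpos.trans_le hle)).mp hηκ)
    have hηpos := mul_pos hη hpos
    have hn : ‖z‖ < 1 := by
      refine norm_lt_one_of_quadratic (a := 2 - γ - η * κ) (b := 1 - γ)
        (abs_lt.mpr ⟨by linarith, by linarith⟩) (abs_lt.mpr ⟨by linarith, by linarith⟩) ?_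
      simpa [modePoly] using h
    exact_mod_cast hn
  -- The spectrum is finite, so its supremum is attained and the strict bound survives.
  have hfin := Module.End.finite_spectrum (K := ℂ)
    ((errorMap J η γ).baseChange ℂ : Module.End ℂ (TensorProduct ℝ ℂ (so d × so d)))
  rw [errorRate, spectralRadius]
  rcases Set.eq_empty_or_nonempty (spectrum ℂ ((errorMap J η γ).baseChange ℂ :
    Module.End ℂ (TensorProduct ℝ ℂ (so d × so d)))) with h0 | h0
  · simp [h0]
  · rw [← sSup_image]
    obtain ⟨z, hz, h⟩ := (h0.image (fun z : ℂ => (‖z‖₊ : ℝ≥0∞))).csSup_mem (hfin.image _)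
    have := hroot z hz
    exact h ▸ this

end ErrorMap

/-! ### Norms adapted to a spectral radius -/

section AdaptedNorm

/-- Gelfand's formula: some power of a complex matrix of spectral radius `< r` has operator norm
`≤ rⁿ`. -/
theorem exists_pow_norm_mulVec_le {ι : Type*} [Fintype ι] [DecidableEq ι] (A : Matrix ι ι ℂ)
    {r : ℝ} (h : spectralRadius ℂ A < ENNReal.ofReal r) :
    ∃ n : ℕ, 0 < n ∧ ∀ v : ι → ℂ, ‖(A ^ n) *ᵥ v‖ ≤ r ^ n * ‖v‖ := by
  let _ : NormedRing (Matrix ι ι ℂ) := Matrix.linftyOpNormedRing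
  let _ : NormedAlgebra ℂ (Matrix ι ι ℂ) := Matrix.linftyOpNormedAlgebra
  have hr : 0 < r := ENNReal.ofReal_pos.mp (bot_le.trans_lt h)
  have hev := (spectrum.pow_norm_pow_one_div_tendsto_nhds_spectralRadius A).eventually_lt_const h
  obtain ⟨n, hn, hlt⟩ := ((eventually_gt_atTop 0).and hev).exists
  refine ⟨n, hn, fun v => (Matrix.linfty_opNorm_mulVec _ _).trans ?_⟩
  refine mul_le_mul_of_nonneg_right ?_ (norm_nonneg v)
  have h1 := (ENNReal.ofReal_lt_ofReal_iff hr).mp hlt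
  have h2 : (‖A ^ n‖ ^ (1 / n : ℝ)) ^ n = ‖A ^ n‖ := by
    rw [one_div]
    exact Real.rpow_inv_natCast_pow (norm_nonneg _) hn.ne'
  rw [← h2]
  exact pow_le_pow_left₀ (by positivity) h1.le n

theorem exists_pow_norm_equivFun_le {V : Type*} [AddCommGroup V] [Module ℝ V] {ι : Type*}
    [Fintype ι] (b : Module.Basis ι ℝ V)
    (T : Module.End ℝ V) {r : ℝ}
    (h : spectralRadius ℂ (A := Module.End ℂ (TensorProduct ℝ ℂ V)) (T.baseChange ℂ) <
      ENNReal.ofReal r) :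
    ∃ n : ℕ, 0 < n ∧ ∀ x, ‖b.equivFun ((T ^ n) x)‖ ≤ r ^ n * ‖b.equivFun x‖ := by
  classical
  have hA : LinearMap.toMatrixAlgEquiv (Algebra.TensorProduct.basis ℂ b) (T.baseChange ℂ) =
      (LinearMap.toMatrix b b T).map (algebraMap ℝ ℂ) := LinearMap.toMatrix_baseChange ℂ T b b
  have hs : spectralRadius ℂ ((LinearMap.toMatrix b b T).map (algebraMap ℝ ℂ)) <
      ENNReal.ofReal r := by
    rw [← hA, spectralRadius, AlgEquiv.spectrum_eq]
    exact h
  obtain ⟨n, hn, hle⟩ := exists_pow_norm_mulVec_le _ hs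
  have hnorm : ∀ v : ι → ℝ, ‖fun i => (v i : ℂ)‖ = ‖v‖ := fun v => by
    simp [Pi.norm_def]
  refine ⟨n, hn, fun x => ?_⟩
  have h1 := hle fun i => (b.equivFun x i : ℂ)
  have h2 : ((LinearMap.toMatrix b b T).map (algebraMap ℝ ℂ) ^ n) *ᵥ
      (fun i => (b.equivFun x i : ℂ)) = fun i => (b.equivFun ((T ^ n) x) i : ℂ) := by
    have h3 : b.equivFun ((T ^ n) x) = (LinearMap.toMatrix b b T) ^ n *ᵥ b.equivFun x := by
      rw [LinearMap.toMatrix_pow]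
      exact (LinearMap.toMatrix_mulVec_repr b b (T ^ n) x).symm
    rw [← Matrix.map_pow, h3]
    exact funext fun i => (RingHom.map_mulVec (algebraMap ℝ ℂ) _ _ i).symm
  rwa [h2, hnorm, hnorm] at h1

variable {V : Type*} [NormedAddCommGroup V] [NormedSpace ℝ V] [FiniteDimensional ℝ V]

/-- An operator on a finite-dimensional real space of (complex) spectral radius `< r` multiplies a
suitable equivalent norm by at most `r`. -/
theorem exists_adapted_norm (T : Module.End ℝ V) {r : ℝ}
    (h : spectralRadius ℂ (A := Module.End ℂ (TensorProduct ℝ ℂ V)) (T.baseChange ℂ) <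
      ENNReal.ofReal r) :
    ∃ (N : Seminorm ℝ V) (c C : ℝ), 0 < c ∧ 0 < C ∧ (∀ x, ‖x‖ ≤ c * N x) ∧
      (∀ x, N x ≤ C * ‖x‖) ∧ ∀ x, N (T x) ≤ r * N x := by
  have hr : 0 < r := ENNReal.ofReal_pos.mp (bot_le.trans_lt h)
  let b := Module.finBasis ℝ V
  obtain ⟨n, hn, hle⟩ := exists_pow_norm_equivFun_le b T h
  let φ := b.equivFun.toContinuousLinearEquiv
  let p : Seminorm ℝ V := (normSeminorm ℝ _).comp b.equivFun.toLinearMap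
  have hp : ∀ x, p x = ‖φ x‖ := fun x => rfl
  -- Applying `T` shifts this sum by one index at the cost of a factor `r`; the new last term is
  -- absorbed by the old first one because `p (T ^ n x) ≤ r ^ n * p x`.
  let N : Seminorm ℝ V :=
    { toFun := fun x => ∑ k ∈ Finset.range n, (r ^ k)⁻¹ * p ((T ^ k) x)
      map_zero' := by simp
      add_le' := fun x y => by
        rw [← Finset.sum_add_distrib]
        refine Finset.sum_le_sum fun k _ => ?_
        rw [← mul_add, map_add]
        exact mul_le_mul_of_nonneg_left (map_add_le_add p _ _) (by positivity)
      neg' := fun x => by simp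
      smul' := fun a x => by
        rw [Finset.mul_sum]
        refine Finset.sum_congr rfl fun k _ => ?_
        rw [map_smul, map_smul_eq_mul]
        ring }
  have hN : ∀ x, N x = ∑ k ∈ Finset.range n, (r ^ k)⁻¹ * p ((T ^ k) x) := fun x => rfl
  have hpN : ∀ x, p x ≤ N x := fun x => by
    have := Finset.single_le_sum (f := fun k => (r ^ k)⁻¹ * p ((T ^ k) x))
      (fun k _ => by positivity) (Finset.mem_range.mpr hn)
    simpa [hN] using this
  refine ⟨N, ‖(φ.symm : (Fin (Module.finrank ℝ V) → ℝ) →L[ℝ] V)‖ + 1,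
    ∑ k ∈ Finset.range n, (r ^ k)⁻¹ * ‖(φ : V →L[ℝ] (Fin (Module.finrank ℝ V) → ℝ)) ∘L LinearMap.toContinuousLinearMap (T ^ k)‖
      + 1, by positivity, by positivity, fun x => ?_, fun x => ?_, fun x => ?_⟩
  · have h1 := (φ.symm : (Fin (Module.finrank ℝ V) → ℝ) →L[ℝ] V).le_opNorm (φ x)
    simp only [ContinuousLinearEquiv.coe_coe, ContinuousLinearEquiv.symm_apply_apply] at h1
    have h2 := hpN x
    rw [hp] at h2
    have h3 := norm_nonneg (φ x)
    have h4 := mul_le_mul_of_nonneg_left h2 (norm_nonneg (φ.symm : (Fin (Module.finrank ℝ V) → ℝ) →L[ℝ] V))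
    linarith
  · rw [add_mul, Finset.sum_mul, hN]
    refine le_add_of_le_of_nonneg (Finset.sum_le_sum fun k _ => ?_) (by positivity)
    rw [mul_assoc]
    refine mul_le_mul_of_nonneg_left ?_ (by positivity)
    exact ((φ : V →L[ℝ] (Fin (Module.finrank ℝ V) → ℝ)) ∘L LinearMap.toContinuousLinearMap (T ^ k)).le_opNorm x
  · obtain ⟨m, rfl⟩ : ∃ m, n = m + 1 := ⟨n - 1, by omega⟩
    have h1 : (r ^ m)⁻¹ * p ((T ^ m) (T x)) ≤ r * p x := by
      rw [← Module.End.mul_apply, ← pow_succ, inv_mul_le_iff₀ (by positivity), ← mul_assoc,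
        ← pow_succ]
      exact hle x
    have h2 : ∀ k, (r ^ k)⁻¹ * p ((T ^ k) (T x)) = r * ((r ^ (k + 1))⁻¹ * p ((T ^ (k + 1)) x)) := by
      intro k
      rw [← Module.End.mul_apply, ← pow_succ, pow_succ r k]
      field_simp
    rw [hN, hN, Finset.sum_range_succ, Finset.sum_range_succ', mul_add, Finset.mul_sum]
    simp only [h2 _]
    rw [← h2 m]
    simp only [pow_zero, inv_one, one_mul, Module.End.one_apply]
    exact add_le_add le_rfl h1

end AdaptedNorm

/-! ### The body-frame step and its linearization -/

noncomputable section LocalStep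

attribute [local instance] Matrix.frobeniusNormedRing Matrix.frobeniusNormedAlgebra

open NormedSpace

section Banach

variable {E A : Type*} [NormedAddCommGroup E] [NormedSpace ℝ E] [NormedRing A] [NormedAlgebra ℝ A]

theorem HasStrictFDerivAt.exp_of_eq_zero [CompleteSpace A] {f : E → A} {f' : E →L[ℝ] A} {p : E}
    (hf : HasStrictFDerivAt f f' p) (h0 : f p = 0) :
    HasStrictFDerivAt (fun x => exp (f x)) f' p := by
  have h1 : HasStrictFDerivAt (exp : A → A) (1 : A →L[ℝ] A) (f p) := by
    rw [h0]; exact hasStrictFDerivAt_exp_zero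
  exact h1.comp p hf

theorem HasStrictFDerivAt.mul_of_eq_one {f g : E → A} {f' g' : E →L[ℝ] A} {p : E}
    (hf : HasStrictFDerivAt f f' p) (hg : HasStrictFDerivAt g g' p) (hf1 : f p = 1)
    (hg1 : g p = 1) : HasStrictFDerivAt (fun x => f x * g x) (f' + g') p := by
  refine (hf.mul' hg).congr_fderiv ?_
  ext x
  simp [hf1, hg1, add_comm]

theorem HasStrictFDerivAt.conj_of_eq_zero {f g h : E → A} {f' g' h' : E →L[ℝ] A} {p : E}
    (hf : HasStrictFDerivAt f f' p) (hg : HasStrictFDerivAt g g' p) (hh : HasStrictFDerivAt h h' p)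
    (hf1 : f p = 1) (hg0 : g p = 0) (hh1 : h p = 1) :
    HasStrictFDerivAt (fun x => f x * g x * h x) g' p := by
  refine ((hf.mul' hg).mul' hh).congr_fderiv ?_
  ext x
  simp [hf1, hg0, hh1]

theorem HasStrictFDerivAt.commutator_conj {f h : E → A} {f' h' : E →L[ℝ] A} {p : E}
    (hf : HasStrictFDerivAt f f' p) (hh : HasStrictFDerivAt h h' p) (hf1 : f p = 1)
    (hh1 : h p = 1) (L : A) :
    HasStrictFDerivAt (fun x => f x * L * h x * L - L * (f x * L * h x))
      (((ContinuousLinearMap.mul ℝ A).flip L - ContinuousLinearMap.mul ℝ A L) ∘L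
        ((ContinuousLinearMap.mul ℝ A).flip L ∘L f' + ContinuousLinearMap.mul ℝ A L ∘L h')) p := by
  have hL := hasStrictFDerivAt_const (𝕜 := ℝ) L p
  have h1 := (hf.mul' hL).mul' hh
  refine ((h1.mul' hL).sub (hL.mul' h1)).congr_fderiv ?_
  ext x
  simp [hf1, hh1]
  abel

end Banach

theorem norm_eq_frobNorm (A : so d) : ‖A‖ = frobNorm (A : Matrix (Fin d) (Fin d) ℝ) := by
  rw [Submodule.coe_norm, Matrix.frobenius_norm_def, frobNorm, frobInner_self, Real.sqrt_eq_rpow]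
  simp

/-- The local logarithm: the local inverse of the matrix exponential at `0`. -/
def localLog (d : ℕ) : Matrix (Fin d) (Fin d) ℝ → Matrix (Fin d) (Fin d) ℝ :=
  HasStrictFDerivAt.localInverse exp
    (ContinuousLinearEquiv.refl ℝ (Matrix (Fin d) (Fin d) ℝ)) 0 hasStrictFDerivAt_exp_zero

theorem hasStrictFDerivAt_localLog :
    HasStrictFDerivAt (localLog d) (ContinuousLinearMap.id ℝ (Matrix (Fin d) (Fin d) ℝ)) 1 := by
  have h := HasStrictFDerivAt.to_localInverse (f := exp)
    (f' := ContinuousLinearEquiv.refl ℝ (Matrix (Fin d) (Fin d) ℝ)) (a := 0)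
    hasStrictFDerivAt_exp_zero
  rw [exp_zero] at h
  exact h

theorem localLog_one : localLog d 1 = 0 := by
  have h := HasStrictFDerivAt.localInverse_apply_image (f := exp)
    (f' := ContinuousLinearEquiv.refl ℝ (Matrix (Fin d) (Fin d) ℝ)) (a := 0)
    hasStrictFDerivAt_exp_zero
  rw [exp_zero] at h
  exact h

theorem eventually_exp_localLog :
    ∀ᶠ Y : Matrix (Fin d) (Fin d) ℝ in 𝓝 1, exp (localLog d Y) = Y := by
  have h := HasStrictFDerivAt.eventually_right_inverse (f := exp)
    (f' := ContinuousLinearEquiv.refl ℝ (Matrix (Fin d) (Fin d) ℝ)) (a := 0)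
    hasStrictFDerivAt_exp_zero
  rw [exp_zero] at h
  exact h

theorem eventually_localLog_exp :
    ∀ᶠ X : Matrix (Fin d) (Fin d) ℝ in 𝓝 0, localLog d (exp X) = X :=
  HasStrictFDerivAt.eventually_left_inverse (f := exp)
    (f' := ContinuousLinearEquiv.refl ℝ (Matrix (Fin d) (Fin d) ℝ)) (a := 0)
    hasStrictFDerivAt_exp_zero

/-- For orthogonal `Y` near `1`, `-(log Y)ᵀ` is another small logarithm of `Y`, and `exp` is
injective near `0`. -/
theorem eventually_localLog_mem_so :
    ∀ᶠ Y : Matrix (Fin d) (Fin d) ℝ in 𝓝 1, Y * Yᵀ = 1 → localLog d Y ∈ so d := by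
  have hlog : Tendsto (localLog d) (𝓝 1) (𝓝 0) := by
    have := (hasStrictFDerivAt_localLog (d := d)).continuousAt.tendsto
    rwa [localLog_one] at this
  have hneg : Tendsto (fun Y => -(localLog d Y)ᵀ) (𝓝 1) (𝓝 0) := by
    have hc : Continuous fun X : Matrix (Fin d) (Fin d) ℝ => -Xᵀ := by fun_prop
    have := (hc.tendsto 0).comp hlog
    rwa [transpose_zero, neg_zero] at this
  filter_upwards [eventually_exp_localLog, hneg.eventually eventually_localLog_exp] with Y h1 h2 hY
  have h3 : exp (-(localLog d Y)ᵀ) = Y := by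
    have h4 : exp (-(localLog d Y)ᵀ) * Yᵀ = 1 := by
      have h5 : exp (localLog d Y)ᵀ = Yᵀ := by rw [Matrix.exp_transpose, h1]
      rw [← h5, ← Matrix.exp_add_of_commute _ _ (Commute.refl (localLog d Y)ᵀ).neg_left]
      simp
    calc exp (-(localLog d Y)ᵀ) = exp (-(localLog d Y)ᵀ) * (Yᵀ * Y) := by
          rw [mul_eq_one_comm.mp hY, mul_one]
      _ = Y := by rw [← mul_assoc, h4, one_mul]
  rw [h3] at h2
  rw [mem_so_iff, eq_neg_iff_add_eq_zero, add_comm, ← eq_neg_iff_add_eq_zero]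
  exact h2

/-- The skew-symmetric part of a matrix. -/
def skewPart (d : ℕ) : Matrix (Fin d) (Fin d) ℝ →L[ℝ] so d :=
  LinearMap.toContinuousLinearMap
    { toFun := fun X => ⟨(1 / 2 : ℝ) • (X - Xᵀ), by
        rw [mem_so_iff, transpose_smul, transpose_sub, transpose_transpose, ← smul_neg, neg_sub]⟩
      map_add' := fun X Y => by
        ext1
        simp only [transpose_add, Submodule.coe_add]
        module
      map_smul' := fun c X => by
        ext1
        simp only [transpose_smul, Submodule.coe_smul, RingHom.id_apply]
        module }

/-- The projection only serves to give ambient matrix formulas values in `so d`; where they are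
already skew it changes nothing. -/
theorem skewPart_of_mem {X : Matrix (Fin d) (Fin d) ℝ} (hX : X ∈ so d) : skewPart d X = ⟨X, hX⟩ := by
  ext1
  change (1 / 2 : ℝ) • (X - Xᵀ) = X
  rw [mem_so_iff.mp hX]
  module

theorem skewPart_coe (A : so d) : skewPart d A = A := skewPart_of_mem A.2

/-- The velocity error after the kick, in the body frame of the state, as a function of the
logarithmic configuration error and the velocity error. -/
def bodyKick (J : Inertia lam) (η γ : ℝ) (x : so d × so d) : so d :=
  (1 - γ) • x.2 + η • (J.op (basePoint lam)).symm
    (torque (basePoint lam) (rotate (expSO (-x.1)) (basePoint lam)))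

/-- One step of the error dynamics in the body frame. The argument `w` is the angular velocity of
the target. -/
def bodyStep (J : Inertia lam) (η γ : ℝ) (p : so d × so d × so d) : so d × so d :=
  (skewPart d (localLog d (exp (p.2.1 : Matrix (Fin d) (Fin d) ℝ) *
      exp (-(p.1 : Matrix (Fin d) (Fin d) ℝ)) *
      exp ((p.1 + bodyKick J η γ p.2 : so d) : Matrix (Fin d) (Fin d) ℝ))),
    skewPart d (exp (-((p.1 + bodyKick J η γ p.2 : so d) : Matrix (Fin d) (Fin d) ℝ)) *
      (bodyKick J η γ p.2 : Matrix (Fin d) (Fin d) ℝ) *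
      exp ((p.1 + bodyKick J η γ p.2 : so d) : Matrix (Fin d) (Fin d) ℝ)))

theorem bodyKick_zero (J : Inertia lam) (η γ : ℝ) : bodyKick J η γ 0 = 0 := by
  have : torque (basePoint lam) (rotate (expSO (-(0 : so d))) (basePoint lam)) = 0 := by
    ext1
    simp [torque, rotate, expSO]
  simp only [bodyKick, Prod.fst_zero, this]
  simp

theorem bodyStep_zero (J : Inertia lam) (η γ : ℝ) (w : so d) : bodyStep J η γ (w, 0) = 0 := by
  have h : exp (-(w : Matrix (Fin d) (Fin d) ℝ)) * exp (w : Matrix (Fin d) (Fin d) ℝ) = 1 := by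
    rw [← Matrix.exp_add_of_commute _ _ (Commute.refl (w : Matrix (Fin d) (Fin d) ℝ)).neg_left]
    simp
  simp [bodyStep, bodyKick_zero, h, localLog_one]

/-- The inclusion of `so d` in the matrices as a continuous linear map. -/
abbrev soIncl (d : ℕ) : so d →L[ℝ] Matrix (Fin d) (Fin d) ℝ := (so d).subtypeL

/-- The derivative of `bodyKick` at `0`. -/
def kickDeriv (J : Inertia lam) (η γ : ℝ) : (so d × so d) →L[ℝ] so d :=
  LinearMap.toContinuousLinearMap (LinearMap.snd ℝ (so d) (so d) ∘ₗ errorMap J η γ)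

/-- To first order `e^{-ξ} Λ e^{ξ} = Λ - [ξ, Λ]`, so the torque is `[Λ, [ξ, Λ]] = -𝒦ξ`. -/
theorem hasStrictFDerivAt_bodyKick (J : Inertia lam) (η γ : ℝ) :
    HasStrictFDerivAt (bodyKick J η γ) (kickDeriv J η γ) 0 := by
  let L : Matrix (Fin d) (Fin d) ℝ := diagonal lam
  let Jinv : so d →L[ℝ] so d :=
    LinearMap.toContinuousLinearMap (J.op (basePoint lam)).symm.toLinearMap
  have h1 : HasStrictFDerivAt (fun x : so d × so d => exp (soIncl d x.1))
      (soIncl d ∘L ContinuousLinearMap.fst ℝ (so d) (so d)) 0 :=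
    HasStrictFDerivAt.exp_of_eq_zero (soIncl d ∘L ContinuousLinearMap.fst ℝ (so d)
      (so d)).hasStrictFDerivAt (by simp)
  have h2 : HasStrictFDerivAt (fun x : so d × so d => exp (-soIncl d x.1))
      (-(soIncl d ∘L ContinuousLinearMap.fst ℝ (so d) (so d))) 0 :=
    HasStrictFDerivAt.exp_of_eq_zero (-(soIncl d ∘L ContinuousLinearMap.fst ℝ (so d)
      (so d))).hasStrictFDerivAt (by simp)
  have h4 := HasStrictFDerivAt.commutator_conj h2 h1 (by simp) (by simp) L
  have h5 := ((ContinuousLinearMap.snd ℝ (so d) (so d)).hasStrictFDerivAt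
    (x := 0)).const_smul (1 - γ) |>.add
    (((Jinv ∘L skewPart d).hasStrictFDerivAt.comp 0 h4).const_smul η)
  refine (h5.congr_of_eventuallyEq (Eventually.of_forall fun x => ?_)).congr_fderiv ?_
  · have : (torque (basePoint lam) (rotate (expSO (-x.1)) (basePoint lam)) : so d) =
        skewPart d (exp (-soIncl d x.1) * L * exp (soIncl d x.1) * L -
          L * (exp (-soIncl d x.1) * L * exp (soIncl d x.1))) := by
      have h6 : (exp (-(x.1 : Matrix (Fin d) (Fin d) ℝ)))ᵀ = exp (x.1 : Matrix (Fin d) (Fin d) ℝ) := by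
        rw [← Matrix.exp_transpose, transpose_neg, so_transpose, neg_neg]
      rw [← skewPart_coe (torque _ _)]
      simp [torque, rotate, expSO, basePoint, h6, L]
    simp only [bodyKick, this]
    rfl
  · refine ContinuousLinearMap.ext fun x => ?_
    have : (stiffness (basePoint lam) x.1 : so d) =
        -skewPart d ((-(x.1 : Matrix (Fin d) (Fin d) ℝ) * L + L * x.1) * L -
          L * (-(x.1 : Matrix (Fin d) (Fin d) ℝ) * L + L * x.1)) := by
      rw [← map_neg, ← skewPart_coe (stiffness _ _)]
      congr 1
      simp only [stiffness, basePoint, LinearMap.coe_mk, AddHom.coe_mk, L]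
      noncomm_ring
    change (1 - γ) • x.2 + η • (J.op (basePoint lam)).symm (skewPart d
      ((-(x.1 : Matrix (Fin d) (Fin d) ℝ) * L + L * x.1) * L -
          L * (-(x.1 : Matrix (Fin d) (Fin d) ℝ) * L + L * x.1))) =
      (1 - γ) • x.2 - η • (J.op (basePoint lam)).symm (stiffness (basePoint lam) x.1)
    rw [this, map_neg, smul_neg, sub_neg_eq_add]

/-- All exponentials equal `1` at the origin, so the logarithm linearizes to `ξ - w + (w + k)` and
`w` cancels. Conjugation contributes nothing, since the conjugated kick vanishes there. -/
theorem hasStrictFDerivAt_bodyStep (J : Inertia lam) (η γ : ℝ) :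
    HasStrictFDerivAt (bodyStep J η γ)
      (LinearMap.toContinuousLinearMap (errorMap J η γ) ∘L
        ContinuousLinearMap.snd ℝ (so d) (so d × so d)) 0 := by
  let E := so d × so d × so d
  let π₁ : E →L[ℝ] so d := ContinuousLinearMap.fst ℝ (so d) (so d × so d)
  let π₂ : E →L[ℝ] so d × so d := ContinuousLinearMap.snd ℝ (so d) (so d × so d)
  let π₃ : E →L[ℝ] so d := ContinuousLinearMap.fst ℝ (so d) (so d) ∘L π₂
  have hk : HasStrictFDerivAt (fun p : E => bodyKick J η γ (π₂ p)) (kickDeriv J η γ ∘L π₂) 0 :=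
    HasStrictFDerivAt.comp 0 (by rw [map_zero]; exact hasStrictFDerivAt_bodyKick J η γ)
      π₂.hasStrictFDerivAt
  have hm := HasStrictFDerivAt.comp (f := fun p : E => bodyKick J η γ (π₂ p)) 0
    ((soIncl d).hasStrictFDerivAt (x := bodyKick J η γ (π₂ 0))) hk
  have hs := HasStrictFDerivAt.comp (f := fun p : E => π₁ p + bodyKick J η γ (π₂ p)) 0
    ((soIncl d).hasStrictFDerivAt (x := π₁ 0 + bodyKick J η γ (π₂ 0)))
    (π₁.hasStrictFDerivAt.add hk)
  have h0 : soIncl d (π₁ 0 + bodyKick J η γ (π₂ 0)) = 0 := by simp [bodyKick_zero]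
  have e1 := HasStrictFDerivAt.exp_of_eq_zero (soIncl d ∘L π₃).hasStrictFDerivAt (p := 0) (by simp)
  have e2 := HasStrictFDerivAt.exp_of_eq_zero (-(soIncl d ∘L π₁)).hasStrictFDerivAt (p := 0)
    (by simp)
  have e3 := HasStrictFDerivAt.exp_of_eq_zero hs h0
  have e4 := HasStrictFDerivAt.exp_of_eq_zero hs.neg (by simpa using h0)
  have g := HasStrictFDerivAt.mul_of_eq_one
    (HasStrictFDerivAt.mul_of_eq_one e1 e2 (by simp) (by simp)) e3 (by simp)
    (by simp [bodyKick_zero])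
  have k := HasStrictFDerivAt.conj_of_eq_zero e4 hm e3 (by simp [bodyKick_zero])
    (by simp [bodyKick_zero]) (by simp [bodyKick_zero])
  have l := (skewPart d).hasStrictFDerivAt.comp 0 (HasStrictFDerivAt.comp 0
    (by
      have h1 : exp ((soIncl d ∘L π₃) 0) * exp ((-(soIncl d ∘L π₁)) 0) *
        exp (soIncl d (π₁ 0 + bodyKick J η γ (π₂ 0))) = 1 := by simp [bodyKick_zero]
      have h2 := hasStrictFDerivAt_localLog (d := d)
      rw [← h1] at h2
      exact h2) g)
  have m := (skewPart d).hasStrictFDerivAt.comp 0 k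
  refine (l.prodMk m).congr_fderiv ?_
  refine ContinuousLinearMap.ext fun p => ?_
  change (skewPart d ((p.2.1 : Matrix (Fin d) (Fin d) ℝ) + -(p.1 : Matrix (Fin d) (Fin d) ℝ) +
      ((p.1 + kickDeriv J η γ p.2 : so d) : Matrix (Fin d) (Fin d) ℝ)),
    skewPart d (kickDeriv J η γ p.2 : Matrix (Fin d) (Fin d) ℝ)) =
    (p.2.1 + kickDeriv J η γ p.2, kickDeriv J η γ p.2)
  rw [skewPart_coe, ← skewPart_coe (p.2.1 + kickDeriv J η γ p.2), Submodule.coe_add,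
    Submodule.coe_add, add_assoc, neg_add_cancel_left]

/-- The body-frame step is, uniformly in small `w`, a small Lipschitz perturbation of the
linearized error dynamics. -/
theorem norm_bodyStep_sub_errorMap_le (J : Inertia lam) (η γ : ℝ) {ε : ℝ} (hε : 0 < ε) :
    ∃ δ > 0, ∀ (w : so d) (x : so d × so d), ‖w‖ < δ → ‖x‖ < δ →
      ‖bodyStep J η γ (w, x) - errorMap J η γ x‖ ≤ ε * ‖x‖ := by
  obtain ⟨s, hs, happ⟩ := (hasStrictFDerivAt_bodyStep J η γ).approximates_deriv_on_nhds
    (c := ⟨ε, hε.le⟩) (Or.inr hε)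
  obtain ⟨δ, hδ, hball⟩ := Metric.mem_nhds_iff.mp hs
  refine ⟨δ, hδ, fun w x hw hx => ?_⟩
  have hmem : ∀ y : so d × so d, ‖y‖ < δ → (w, y) ∈ s := fun y hy => hball (by
    rw [mem_ball_zero_iff]
    exact max_lt hw hy)
  -- Strict differentiability allows comparison with `(w, 0)`, a zero of the step, instead of the
  -- origin; the error is then bounded by `‖x‖` alone, without `‖w‖`.
  have h := happ (w, x) (hmem x hx) (w, 0) (hmem 0 (by simpa using hδ))
  rw [bodyStep_zero, sub_zero] at h
  have hd : (w, x) - (w, 0) = ((0 : so d), x) :=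
    Prod.ext (sub_self w) (sub_zero x)
  have hn : ‖((0 : so d), x)‖ = ‖x‖ := by
    rw [Prod.norm_mk, norm_zero, max_eq_right (norm_nonneg x)]
  rw [hd, hn] at h
  exact h

/-- The product on the right is a rotation close to `1`, so its local logarithm is genuine and
already skew. -/
theorem exp_bodyStep_fst (J : Inertia lam) (η γ : ℝ) :
    ∃ δ > 0, ∀ (w : so d) (x : so d × so d), ‖w‖ < δ → ‖x‖ < δ →
      exp ((bodyStep J η γ (w, x)).1 : Matrix (Fin d) (Fin d) ℝ) =
        exp (x.1 : Matrix (Fin d) (Fin d) ℝ) * exp (-(w : Matrix (Fin d) (Fin d) ℝ)) *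
          exp ((w + bodyKick J η γ x : so d) : Matrix (Fin d) (Fin d) ℝ) := by
  let G : so d × so d × so d → Matrix (Fin d) (Fin d) ℝ := fun p =>
    exp (p.2.1 : Matrix (Fin d) (Fin d) ℝ) * exp (-(p.1 : Matrix (Fin d) (Fin d) ℝ)) *
      exp ((p.1 + bodyKick J η γ p.2 : so d) : Matrix (Fin d) (Fin d) ℝ)
  have hG : Tendsto G (𝓝 0) (𝓝 1) := by
    have hk : ContinuousAt (fun p : so d × so d × so d => bodyKick J η γ p.2) 0 :=
      ContinuousAt.comp (g := bodyKick J η γ) (f := Prod.snd)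
        (hasStrictFDerivAt_bodyKick J η γ).continuousAt continuousAt_snd
    have he : ∀ {f : so d × so d × so d → Matrix (Fin d) (Fin d) ℝ}, ContinuousAt f 0 → f 0 = 0 →
        Tendsto (fun p => exp (f p)) (𝓝 0) (𝓝 1) := fun {f} hf h0 => by
      have h1 : Tendsto (exp : Matrix (Fin d) (Fin d) ℝ → _) (𝓝 (f 0)) (𝓝 1) := by
        have := (hasStrictFDerivAt_exp_zero (𝕂 := ℝ) (𝔸 := Matrix (Fin d) (Fin d) ℝ)).continuousAt
        rw [ContinuousAt, exp_zero] at this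
        rwa [h0]
      exact h1.comp hf
    have h1 := he (f := fun p => (p.2.1 : Matrix (Fin d) (Fin d) ℝ)) (by fun_prop) (by simp)
    have h2 := he (f := fun p => -(p.1 : Matrix (Fin d) (Fin d) ℝ)) (by fun_prop) (by simp)
    have h3 := he (f := fun p => ((p.1 + bodyKick J η γ p.2 : so d) : Matrix (Fin d) (Fin d) ℝ))
      (continuous_subtype_val.continuousAt.comp (continuousAt_fst.add hk))
      (by simp [bodyKick_zero])
    have := (h1.mul h2).mul h3
    rwa [one_mul, one_mul] at this
  obtain ⟨δ, hδ, h⟩ := Metric.eventually_nhds_iff.mp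
    (hG.eventually (eventually_exp_localLog.and eventually_localLog_mem_so))
  refine ⟨δ, hδ, fun w x hw hx => ?_⟩
  obtain ⟨h1, h2⟩ := h (y := (w, x)) (by
    rw [dist_zero_right]
    exact max_lt hw hx)
  have hSO : G (w, x) ∈ SO d := by
    exact (SO d).mul_mem ((SO d).mul_mem (exp_mem_SO _) (exp_mem_SO (-w))) (exp_mem_SO _)
  change exp ((skewPart d (localLog d (G (w, x))) : so d) : Matrix (Fin d) (Fin d) ℝ) = _
  rw [skewPart_of_mem (h2 (mem_SO_iff.mp hSO).1)]
  exact h1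

end LocalStep

/-! ### Rotations acting on the orbit and on `so d` -/

section Action

theorem coe_inv_SO (Q : SO d) :
    ((Q⁻¹ : SO d) : Matrix (Fin d) (Fin d) ℝ) = (Q : Matrix (Fin d) (Fin d) ℝ)ᵀ := rfl

theorem rotate_mul (P Q : SO d) (M : orbit lam) : rotate (P * Q) M = rotate P (rotate Q M) := by
  ext1
  simp [rotate, Matrix.mul_assoc]

theorem rotate_one (M : orbit lam) : rotate 1 M = M := by
  ext1
  simp [rotate]

theorem adjoint_mul (P Q : SO d) (A : so d) : adjoint (P * Q) A = adjoint P (adjoint Q A) := by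
  ext1
  simp [adjoint, Matrix.mul_assoc]

theorem adjoint_one (A : so d) : adjoint 1 A = A := by
  ext1
  simp [adjoint]

theorem adjoint_add (Q : SO d) (A B : so d) : adjoint Q (A + B) = adjoint Q A + adjoint Q B := by
  ext1
  simp [adjoint, Matrix.mul_add, Matrix.add_mul]

theorem adjoint_smul (Q : SO d) (c : ℝ) (A : so d) : adjoint Q (c • A) = c • adjoint Q A := by
  ext1
  simp [adjoint]

theorem adjoint_adjoint_inv (Q : SO d) (A : so d) : adjoint Q (adjoint Q⁻¹ A) = A := by
  rw [← adjoint_mul, mul_inv_cancel, adjoint_one]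

theorem frobNorm_adjoint (Q : SO d) (A : so d) :
    frobNorm (adjoint Q A : Matrix (Fin d) (Fin d) ℝ) = frobNorm (A : Matrix (Fin d) (Fin d) ℝ) := by
  have h := SO_transpose_mul Q
  simp only [frobNorm, frobInner, adjoint, transpose_mul, transpose_transpose]
  generalize (Q : Matrix (Fin d) (Fin d) ℝ) = q at *
  generalize (A : Matrix (Fin d) (Fin d) ℝ) = a
  rw [show q * (aᵀ * qᵀ) * (q * a * qᵀ) = q * (aᵀ * (qᵀ * q) * a * qᵀ) by
    simp only [Matrix.mul_assoc], h, Matrix.mul_one, Matrix.trace_mul_comm, Matrix.mul_assoc, h,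
    Matrix.mul_one]

theorem expSO_neg (A : so d) : expSO (-A) = (expSO A)⁻¹ := by
  ext1
  rw [coe_inv_SO]
  simp only [expSO, ← Matrix.exp_transpose, so_transpose, NegMemClass.coe_neg]

theorem expSO_zero : expSO (0 : so d) = 1 := by
  ext1
  simp [expSO]

theorem expSO_add_of_commute {A B : so d}
    (h : Commute (A : Matrix (Fin d) (Fin d) ℝ) (B : Matrix (Fin d) (Fin d) ℝ)) :
    expSO (A + B) = expSO A * expSO B := by
  ext1
  exact Matrix.exp_add_of_commute _ _ h

theorem expSO_adjoint (Q : SO d) (A : so d) : expSO (adjoint Q A) = Q * expSO A * Q⁻¹ := by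
  ext1
  have h := (mem_SO_iff.mp Q.2).1
  have hu : IsUnit (Q : Matrix (Fin d) (Fin d) ℝ) := IsUnit.of_mul_eq_one _ h
  have hi : (Q : Matrix (Fin d) (Fin d) ℝ)⁻¹ = (Q : Matrix (Fin d) (Fin d) ℝ)ᵀ :=
    Matrix.inv_eq_right_inv h
  have := Matrix.exp_conj (Q : Matrix (Fin d) (Fin d) ℝ) (A : Matrix (Fin d) (Fin d) ℝ) hu
  rw [hi] at this
  exact this

theorem adjoint_expSO_of_commute {A B : so d}
    (h : Commute (A : Matrix (Fin d) (Fin d) ℝ) (B : Matrix (Fin d) (Fin d) ℝ)) :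
    adjoint (expSO A) B = B := by
  ext1
  have h1 : Commute (NormedSpace.exp (A : Matrix (Fin d) (Fin d) ℝ))
    (B : Matrix (Fin d) (Fin d) ℝ) := h.exp_left
  have h2 := (mem_SO_iff.mp (exp_mem_SO A)).1
  simp only [adjoint, expSO]
  rw [h1.eq, Matrix.mul_assoc, h2, Matrix.mul_one]

theorem exists_rotate_basePoint (M : orbit lam) : ∃ Q : SO d, M = rotate Q (basePoint lam) := by
  obtain ⟨Q, hQ, h⟩ := M.2
  exact ⟨⟨Q, hQ⟩, Subtype.ext h⟩

theorem torque_rotate (Q : SO d) (M C : orbit lam) :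
    torque (rotate Q M) (rotate Q C) = adjoint Q (torque M C) := by
  ext1
  have h := SO_transpose_mul Q
  simp only [torque, rotate, adjoint]
  generalize (Q : Matrix (Fin d) (Fin d) ℝ) = q at *
  have key : ∀ a b : Matrix (Fin d) (Fin d) ℝ, q * a * qᵀ * (q * b * qᵀ) = q * (a * b) * qᵀ := by
    intro a b
    rw [show q * a * qᵀ * (q * b * qᵀ) = q * a * (qᵀ * q) * b * qᵀ by
      simp only [Matrix.mul_assoc], h, Matrix.mul_one, Matrix.mul_assoc q]
  rw [key, key, Matrix.mul_sub, Matrix.sub_mul]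

theorem inertia_symm_adjoint (J : Inertia lam) (Q : SO d) (M : orbit lam) (A : so d) :
    (J.op (rotate Q M)).symm (adjoint Q A) = adjoint Q ((J.op M).symm A) := by
  rw [LinearEquiv.symm_apply_eq, J.equivariant', LinearEquiv.apply_symm_apply]

theorem orbitDist_le {M N : orbit lam} (ξ : so d) (h : rotate (expSO ξ) N = M) :
    orbitDist M N ≤ ENNReal.ofReal (frobNorm (ξ : Matrix (Fin d) (Fin d) ℝ)) :=
  iInf₂_le ξ h

/-- This is why no smallness of `Ω⋆` is needed in the plane. -/
theorem commute_so_two (A B : so 2) :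
    Commute (A : Matrix (Fin 2) (Fin 2) ℝ) (B : Matrix (Fin 2) (Fin 2) ℝ) := by
  have h : ∀ (X : so 2) i j, (X : Matrix (Fin 2) (Fin 2) ℝ) j i =
      -(X : Matrix (Fin 2) (Fin 2) ℝ) i j := fun X i j => congrFun (congrFun (so_transpose X) i) j
  have h0 : ∀ (X : so 2) i, (X : Matrix (Fin 2) (Fin 2) ℝ) i i = 0 := fun X i => by
    linarith [h X i i]
  ext i j
  fin_cases i <;> fin_cases j <;>
    simp [Matrix.mul_apply, Fin.sum_univ_two, h0, h _ 0 1] <;> ring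

end Action

/-! ### Reduction of the algorithm to the body frame -/

section BodyFrame

/-- In the body frame `Q` of the state `M = QΛQᵀ`, the tracking error of `(M, Ω)` relative to the
target `(Ms, Ωs)` has the coordinates `x = (ξ, v)`: `Ms = Q exp(-ξ) Λ exp(ξ) Qᵀ` and
`Ω = Ωs + Q v Qᵀ`. -/
structure IsBodyError (Ωs : so d) (Ms : orbit lam) (s : orbit lam × so d) (Q : SO d)
    (x : so d × so d) : Prop where
  state : s.1 = rotate Q (basePoint lam)
  target : Ms = rotate (Q * expSO (-x.1)) (basePoint lam)
  velocity : s.2 = Ωs + adjoint Q x.2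

/-- The configuration and velocity errors obtained from `x` by one step of the algorithm, in the
body frame; `w` is the angular velocity of the target in the body frame. -/
structure IsBodySuccessor (J : Inertia lam) (η γ : ℝ) (w : so d) (x y : so d × so d) : Prop where
  exp_fst : expSO y.1 = expSO x.1 * expSO (-w) * expSO (w + bodyKick J η γ x)
  snd : y.2 = adjoint (expSO (-(w + bodyKick J η γ x))) (bodyKick J η γ x)

theorem IsBodyError.step {J : Inertia lam} {η γ : ℝ} {Ωs : so d} {Ms : orbit lam}
    {s : orbit lam × so d} {Q : SO d} {x y : so d × so d} (h : IsBodyError Ωs Ms s Q x)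
    (hy : IsBodySuccessor J η γ (adjoint Q⁻¹ Ωs) x y) :
    ∃ Q', IsBodyError Ωs (rotate (expSO Ωs) Ms) (kickDrift J η γ Ωs Ms s) Q' y := by
  obtain ⟨M, Ω⟩ := s
  obtain ⟨h1, h2, h3⟩ := h
  obtain ⟨hy1, hy2⟩ := hy
  simp only at h1 h2 h3
  set w := adjoint Q⁻¹ Ωs with hw
  set k := bodyKick J η γ x with hk
  have hΩs : adjoint Q w = Ωs := adjoint_adjoint_inv Q Ωs
  have hkick : Ωs + (1 - γ) • (Ω - Ωs) + η • (J.op M).symm (torque M Ms) = adjoint Q (w + k) := by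
    rw [h1, h2, rotate_mul, torque_rotate, inertia_symm_adjoint, h3, hk, bodyKick, adjoint_add,
      adjoint_add, adjoint_smul, adjoint_smul, hΩs, add_sub_cancel_left, add_assoc]
  have hdrift : kickDrift J η γ Ωs Ms (M, Ω) =
      (rotate (expSO (adjoint Q (w + k))) M, adjoint Q (w + k)) := by
    simp only [kickDrift, hkick]
  rw [hdrift]
  -- The new frame is the old one carried along by the drift, since `e^{Q(w+k)Qᵀ} Q = Q e^{w+k}`.
  refine ⟨Q * expSO (w + k), ?_, ?_, ?_⟩
  · simp only
    rw [h1, ← rotate_mul, expSO_adjoint, inv_mul_cancel_right]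
  · rw [h2, ← rotate_mul]
    congr 1
    rw [← hΩs, expSO_adjoint, expSO_neg y.1, hy1, expSO_neg, expSO_neg]
    group
  · simp only
    rw [hy2, ← adjoint_mul, expSO_neg, mul_inv_cancel_right, adjoint_add, hΩs]

theorem IsBodyError.rotate_expSO {Ωs : so d} {Ms : orbit lam} {s : orbit lam × so d} {Q : SO d}
    {x : so d × so d} (h : IsBodyError Ωs Ms s Q x) :
    rotate (expSO (adjoint Q x.1)) Ms = s.1 := by
  rw [h.target, h.state, ← rotate_mul, expSO_adjoint, expSO_neg]
  congr 1
  group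

/-- Only an inequality: `x.1` yields one logarithm among those in the infimum, not necessarily the
shortest. -/
theorem IsBodyError.error_le {Ωs : so d} {Ms : orbit lam} {s : orbit lam × so d} {Q : SO d}
    {x : so d × so d} (h : IsBodyError Ωs Ms s Q x) :
    orbitDist s.1 Ms + ENNReal.ofReal (frobNorm ((s.2 - Ωs : so d) : Matrix (Fin d) (Fin d) ℝ)) ≤
      ENNReal.ofReal (frobNorm (x.1 : Matrix (Fin d) (Fin d) ℝ)) +
        ENNReal.ofReal (frobNorm (x.2 : Matrix (Fin d) (Fin d) ℝ)) := by
  refine add_le_add ?_ (le_of_eq ?_)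
  · rw [← frobNorm_adjoint Q x.1]
    exact orbitDist_le _ h.rotate_expSO
  · rw [h.velocity, add_sub_cancel_left, frobNorm_adjoint]

theorem exists_isBodyError (Ωs : so d) {Ms : orbit lam} {s : orbit lam × so d} {ξ : so d}
    (h : rotate (expSO ξ) Ms = s.1) :
    ∃ Q x, IsBodyError Ωs Ms s Q x ∧
      frobNorm (x.1 : Matrix (Fin d) (Fin d) ℝ) = frobNorm (ξ : Matrix (Fin d) (Fin d) ℝ) ∧
      frobNorm (x.2 : Matrix (Fin d) (Fin d) ℝ) =
        frobNorm ((s.2 - Ωs : so d) : Matrix (Fin d) (Fin d) ℝ) := by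
  obtain ⟨Q, hQ⟩ := exists_rotate_basePoint s.1
  refine ⟨Q, (adjoint Q⁻¹ ξ, adjoint Q⁻¹ (s.2 - Ωs)), ⟨hQ, ?_, ?_⟩, frobNorm_adjoint _ _,
    frobNorm_adjoint _ _⟩
  · rw [expSO_neg, expSO_adjoint, show Q * (Q⁻¹ * expSO ξ * Q⁻¹⁻¹)⁻¹ = (expSO ξ)⁻¹ * Q by group,
      rotate_mul, ← hQ, ← h, ← rotate_mul, inv_mul_cancel, rotate_one]
  · simp only
    rw [adjoint_adjoint_inv, add_sub_cancel]

end BodyFrame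

/-! ### Contraction of the error and return to the orbit distance -/

section Contraction

attribute [local instance] Matrix.frobeniusNormedRing Matrix.frobeniusNormedAlgebra

theorem bodyStep_snd (J : Inertia lam) (η γ : ℝ) (w : so d) (x : so d × so d) :
    (bodyStep J η γ (w, x)).2 =
      adjoint (expSO (-(w + bodyKick J η γ x))) (bodyKick J η γ x) := by
  rw [← skewPart_coe (adjoint _ _)]
  have h : ((expSO (-(w + bodyKick J η γ x)) : SO d) : Matrix (Fin d) (Fin d) ℝ)ᵀ =
      NormedSpace.exp ((w + bodyKick J η γ x : so d) : Matrix (Fin d) (Fin d) ℝ) := by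
    rw [expSO_neg, coe_inv_SO, transpose_transpose]
    rfl
  simp only [adjoint, h]
  rfl

theorem exists_isBodySuccessor (J : Inertia lam) (η γ : ℝ) {ε : ℝ} (hε : 0 < ε) :
    ∃ ω₀ > 0, ∃ δ > 0, ∀ (w : so d) (x : so d × so d), (d = 2 ∨ ‖w‖ < ω₀) → ‖x‖ < δ →
      ∃ y, IsBodySuccessor J η γ w x y ∧ ‖y - errorMap J η γ x‖ ≤ ε * ‖x‖ := by
  obtain ⟨δ₁, hδ₁, h₁⟩ := norm_bodyStep_sub_errorMap_le J η γ hε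
  obtain ⟨δ₂, hδ₂, h₂⟩ := exp_bodyStep_fst J η γ
  have succ : ∀ (w : so d) (x : so d × so d), ‖w‖ < δ₂ → ‖x‖ < δ₂ →
      IsBodySuccessor J η γ w x (bodyStep J η γ (w, x)) := fun w x hw hx =>
    ⟨Subtype.ext (h₂ w x hw hx), bodyStep_snd J η γ w x⟩
  refine ⟨min δ₁ δ₂, lt_min hδ₁ hδ₂, min δ₁ δ₂, lt_min hδ₁ hδ₂, fun w x hw hx => ?_⟩
  obtain ⟨hx1, hx2⟩ := lt_min_iff.mp hx
  rcases hw with hd | hw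
  -- In the plane the exponentials split and conjugation is trivial, so the successor computed at `w
  -- = 0` serves every `w`.
  · subst hd
    refine ⟨bodyStep J η γ (0, x), ?_, h₁ 0 x (by simpa using hδ₁) hx1⟩
    obtain ⟨e1, e2⟩ := succ 0 x (by simpa using hδ₂) hx2
    refine ⟨?_, ?_⟩
    · rw [e1, expSO_add_of_commute (commute_so_two w _), neg_zero, expSO_zero, zero_add,
        expSO_neg, mul_one]
      group
    · rw [e2, adjoint_expSO_of_commute (commute_so_two _ _),
        adjoint_expSO_of_commute (commute_so_two _ _)]
  · obtain ⟨hw1, hw2⟩ := lt_min_iff.mp hw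
    exact ⟨_, succ w x hw2 hx2, h₁ w x hw1 hx1⟩

/-- In a norm adapted to the linearized error dynamics, each step contracts small errors by the
factor `r`. -/
theorem exists_contraction (J : Inertia lam) {η γ r : ℝ}
    (hr : errorRate J η γ < ENNReal.ofReal r) :
    ∃ (N : so d × so d → ℝ) (c C : ℝ), 0 < c ∧ 0 < C ∧ (∀ x, ‖x‖ ≤ c * N x) ∧
      (∀ x, N x ≤ C * ‖x‖) ∧ ∃ ω₀ > 0, ∃ δ > 0, ∀ (w : so d) (x : so d × so d),
        (d = 2 ∨ ‖w‖ < ω₀) → N x < δ → ∃ y, IsBodySuccessor J η γ w x y ∧ N y ≤ r * N x := by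
  -- The norm is adapted to `r' < r`; the gap `r - r'`, divided by the norm-comparison constants, is
  -- the allowance for the nonlinear remainder.
  obtain ⟨r', -, hr1, hr2⟩ := ENNReal.lt_iff_exists_real_btwn.mp hr
  have hr0 : 0 < r := ENNReal.ofReal_pos.mp (bot_le.trans_lt hr)
  have hlt : r' < r := (ENNReal.ofReal_lt_ofReal_iff hr0).mp hr2
  obtain ⟨N, c, C, hc, hC, hNc, hNC, hN⟩ := exists_adapted_norm (errorMap J η γ) hr1
  obtain ⟨ω₀, hω, δ, hδ, h⟩ := exists_isBodySuccessor J η γ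
    (ε := (r - r') / (C * c)) (div_pos (by linarith) (by positivity))
  refine ⟨N, c, C, hc, hC, hNc, hNC, ω₀, hω, δ / c, by positivity, fun w x hw hx => ?_⟩
  have hxδ : ‖x‖ < δ := (hNc x).trans_lt (by rwa [lt_div_iff₀' hc] at hx)
  obtain ⟨y, hy, hle⟩ := h w x hw hxδ
  refine ⟨y, hy, ?_⟩
  have h1 : N y ≤ N (errorMap J η γ x) + N (y - errorMap J η γ x) := by
    simpa using map_add_le_add N (errorMap J η γ x) (y - errorMap J η γ x)
  have h2 : N (y - errorMap J η γ x) ≤ (r - r') * N x := by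
    calc N (y - errorMap J η γ x) ≤ C * ((r - r') / (C * c) * (c * N x)) :=
          (hNC _).trans (mul_le_mul_of_nonneg_left (hle.trans (mul_le_mul_of_nonneg_left (hNc x)
            (div_nonneg (by linarith) (by positivity)))) hC.le)
      _ = (r - r') * N x := by field_simp
  linarith [hN x]

/-- The frame differs at each step, but rotating `Ω⋆` into it preserves the norm, so one threshold
`ω₀` works for all times; `r < 1` keeps the error below `δ`. -/
theorem exists_isBodyError_iterates {J : Inertia lam} {η γ r ω₀ δ : ℝ} (hr0 : 0 < r) (hr1 : r < 1)
    {N : so d × so d → ℝ} (hN0 : ∀ x, 0 ≤ N x)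
    (h : ∀ (w : so d) (x : so d × so d), (d = 2 ∨ ‖w‖ < ω₀) → N x < δ →
      ∃ y, IsBodySuccessor J η γ w x y ∧ N y ≤ r * N x)
    {Ωs : so d} (hΩs : d = 2 ∨ ‖Ωs‖ < ω₀) {Ms0 M0 : orbit lam} {Ω0 : so d} {Q : SO d}
    {x : so d × so d} (hx : IsBodyError Ωs Ms0 (M0, Ω0) Q x) (hδ : N x < δ) (t : ℕ) :
    ∃ Q' y, IsBodyError Ωs (target Ωs Ms0 t) (iterates J η γ Ωs Ms0 M0 Ω0 t) Q' y ∧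
      N y ≤ r ^ t * N x := by
  induction t with
  | zero => exact ⟨Q, x, hx, by simp⟩
  | succ t ih =>
    obtain ⟨P, y, hy, hle⟩ := ih
    have hyδ : N y < δ :=
      (hle.trans (mul_le_of_le_one_left (hN0 x) (pow_le_one₀ hr0.le hr1.le))).trans_lt hδ
    obtain ⟨z, hz, hzle⟩ := h (adjoint P⁻¹ Ωs) y
      (hΩs.imp_right fun hlt => by rwa [norm_eq_frobNorm, frobNorm_adjoint, ← norm_eq_frobNorm])
      hyδ
    obtain ⟨P', hP'⟩ := hy.step hz
    refine ⟨P', z, hP', hzle.trans ?_⟩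
    rw [pow_succ', mul_assoc]
    exact mul_le_mul_of_nonneg_left hle hr0.le

theorem local_tracking (J : Inertia lam) {η γ r : ℝ} (hr : errorRate J η γ < ENNReal.ofReal r)
    (hr1 : r < 1) :
    ∃ ω₀ > (0 : ℝ), ∃ δ > (0 : ℝ), ∃ K > (0 : ℝ),
      ∀ Ωs : so d, (d = 2 ∨ frobNorm (Ωs : Matrix (Fin d) (Fin d) ℝ) < ω₀) →
      ∀ (Ms0 M0 : orbit lam) (Ω0 : so d),
        trackingError J η γ Ωs Ms0 M0 Ω0 0 < ENNReal.ofReal δ → ∀ t : ℕ,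
          trackingError J η γ Ωs Ms0 M0 Ω0 t ≤
            ENNReal.ofReal (K * r ^ t) * trackingError J η γ Ωs Ms0 M0 Ω0 0 := by
  have hr0 : 0 < r := ENNReal.ofReal_pos.mp (bot_le.trans_lt hr)
  obtain ⟨N, c, C, hc, hC, hNc, hNC, ω₀, hω, δ, hδ, h⟩ := exists_contraction J hr
  have hN0 : ∀ x, 0 ≤ N x := fun x =>
    nonneg_of_mul_nonneg_right ((norm_nonneg x).trans (hNc x)) hc
  -- `C` enters when the initial error is measured by `N`, `c` on the way back, and `2` because a
  -- sum of two norms is at most twice their maximum.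
  refine ⟨ω₀, hω, δ / C, by positivity, 2 * c * C, by positivity,
    fun Ωs hΩs Ms0 M0 Ω0 he t => ?_⟩
  simp only [← norm_eq_frobNorm] at hΩs
  have key : ∀ ξ : so d, rotate (expSO ξ) Ms0 = M0 → ‖ξ‖ + ‖Ω0 - Ωs‖ < δ / C →
      trackingError J η γ Ωs Ms0 M0 Ω0 t ≤
        ENNReal.ofReal (2 * c * C * r ^ t) * ENNReal.ofReal (‖ξ‖ + ‖Ω0 - Ωs‖) := by
    intro ξ hξ hlt
    obtain ⟨Q, x, hx, hx1, hx2⟩ := exists_isBodyError Ωs (s := (M0, Ω0)) hξ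
    simp only [← norm_eq_frobNorm] at hx1 hx2
    have hxle : ‖x‖ ≤ ‖ξ‖ + ‖Ω0 - Ωs‖ := by
      rw [Prod.norm_def, hx1, hx2]
      exact max_le_add_of_nonneg (norm_nonneg _) (norm_nonneg _)
    have hxδ : N x < δ := by
      rw [lt_div_iff₀' hC] at hlt
      exact ((hNC x).trans (mul_le_mul_of_nonneg_left hxle hC.le)).trans_lt hlt
    obtain ⟨Q', y, hy, hle⟩ := exists_isBodyError_iterates hr0 hr1 hN0 h hΩs hx hxδ t
    refine hy.error_le.trans ?_
    rw [← norm_eq_frobNorm, ← norm_eq_frobNorm, ← ENNReal.ofReal_add (norm_nonneg _) (norm_nonneg _),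
      ← ENNReal.ofReal_mul (by positivity)]
    refine ENNReal.ofReal_le_ofReal ?_
    calc ‖y.1‖ + ‖y.2‖ ≤ 2 * ‖y‖ := by linarith [norm_fst_le y, norm_snd_le y]
      _ ≤ 2 * (c * (r ^ t * (C * (‖ξ‖ + ‖Ω0 - Ωs‖)))) := by
        gcongr
        refine (hNc y).trans (mul_le_mul_of_nonneg_left (hle.trans ?_) hc.le)
        exact mul_le_mul_of_nonneg_left
          ((hNC x).trans (mul_le_mul_of_nonneg_left hxle hC.le)) (by positivity)
      _ = 2 * c * C * r ^ t * (‖ξ‖ + ‖Ω0 - Ωs‖) := by ring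
  have ha0 : ENNReal.ofReal (2 * c * C * r ^ t) ≠ 0 :=
    (ENNReal.ofReal_pos.mpr (by positivity)).ne'
  set e := trackingError J η γ Ωs Ms0 M0 Ω0 0 with he_def
  have hinf : ∀ b : ℝ≥0∞, e < b → ∃ ξ : so d, rotate (expSO ξ) Ms0 = M0 ∧
      ENNReal.ofReal (‖ξ‖ + ‖Ω0 - Ωs‖) < b := by
    intro b hb
    have h0 : e = orbitDist M0 Ms0 + ENNReal.ofReal ‖Ω0 - Ωs‖ := by
      rw [norm_eq_frobNorm]
      rfl
    rw [h0, ← lt_tsub_iff_right, orbitDist] at hb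
    obtain ⟨ξ, hb⟩ := iInf_lt_iff.mp hb
    obtain ⟨hξ, hb⟩ := iInf_lt_iff.mp hb
    refine ⟨ξ, hξ, ?_⟩
    rwa [lt_tsub_iff_right, ← norm_eq_frobNorm,
      ← ENNReal.ofReal_add (norm_nonneg _) (norm_nonneg _)] at hb
  -- No minimizing logarithm is assumed: if the bound failed, some admissible `ξ` would be close
  -- enough to the infimum to satisfy the smallness condition and contradict `key`.
  by_contra! hcon
  have hlt : e < trackingError J η γ Ωs Ms0 M0 Ω0 t / ENNReal.ofReal (2 * c * C * r ^ t) := by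
    rw [ENNReal.lt_div_iff_mul_lt (Or.inl ha0) (Or.inl ENNReal.ofReal_ne_top), mul_comm]
    exact hcon
  obtain ⟨ξ, hξ, hb⟩ := hinf _ (lt_min hlt he)
  obtain ⟨hb1, hb2⟩ := lt_min_iff.mp hb
  rw [ENNReal.lt_div_iff_mul_lt (Or.inl ha0) (Or.inl ENNReal.ofReal_ne_top), mul_comm] at hb1
  exact hb1.not_ge (key ξ hξ ((ENNReal.ofReal_lt_ofReal_iff (by positivity)).mp hb2))

end Contraction

end KGMRF

open KGMRF
theorem theorem2 (d : ℕ) (hd : 2 ≤ d) (lam : Fin d → ℝ) (hlam : StrictAnti lam)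
    (hpos : ∀ i, 0 < lam i) (J : Inertia lam) (η γ : ℝ) (hD : (η, γ) ∈ stabilityDomain J) :
    errorRate J η γ < 1 ∧
    ∀ r : ℝ, errorRate J η γ < ENNReal.ofReal r → r < 1 →
      ∃ ω₀ > (0 : ℝ), ∃ δ > (0 : ℝ), ∃ K > (0 : ℝ),
        ∀ Ωs : so d, (d = 2 ∨ frobNorm (Ωs : Matrix (Fin d) (Fin d) ℝ) < ω₀) →
        ∀ (Ms0 M0 : orbit lam) (Ω0 : so d),
          trackingError J η γ Ωs Ms0 M0 Ω0 0 < ENNReal.ofReal δ →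
          (∀ t : ℕ, trackingError J η γ Ωs Ms0 M0 Ω0 t ≤
            ENNReal.ofReal (K * r ^ t) * trackingError J η γ Ωs Ms0 M0 Ω0 0) ∧
          Tendsto (fun t => orbitDist (iterates J η γ Ωs Ms0 M0 Ω0 t).1 (target Ωs Ms0 t))
            atTop (𝓝 0) := by
  refine ⟨errorRate_lt_one hlam J hD, fun r hr hr1 => ?_⟩
  obtain ⟨ω₀, hω, δ, hδ, K, hK, h⟩ := local_tracking J hr hr1
  refine ⟨ω₀, hω, δ, hδ, K, hK, fun Ωs hΩs Ms0 M0 Ω0 he => ?_⟩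
  have hbound := h Ωs hΩs Ms0 M0 Ω0 he
  refine ⟨hbound, ?_⟩
  have hr0 : 0 < r := ENNReal.ofReal_pos.mp (bot_le.trans_lt hr)
  have hlim : Tendsto (fun t : ℕ => ENNReal.ofReal (K * r ^ t) *
      trackingError J η γ Ωs Ms0 M0 Ω0 0) atTop (𝓝 0) := by
    have h1 : Tendsto (fun t : ℕ => K * r ^ t) atTop (𝓝 0) := by
      simpa using (tendsto_pow_atTop_nhds_zero_of_lt_one hr0.le hr1).const_mul K
    -- The initial error is finite because it is below `δ`, so the product with it still tends to
    -- `0`.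
    have h2 := ENNReal.Tendsto.mul_const (b := trackingError J η γ Ωs Ms0 M0 Ω0 0)
      (ENNReal.tendsto_ofReal h1) (Or.inr (he.trans ENNReal.ofReal_lt_top).ne)
    simpa using h2
  exact tendsto_of_tendsto_of_tendsto_of_le_of_le tendsto_const_nhds hlim (fun _ => bot_le)
    fun t => le_self_add.trans (hbound t)
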